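/- Let $\mathbb{F}\in\{\mathbb{R},\mathbb{C}\}$. For a real random variable $X$ let $\|X\|_{\psi_2}=\inf\{t>0:\mathbb{E}e^{|X|^2/t^2}\le 2\}$. A mean-zero random vector $y\in\mathbb{R}^p$ with finite second moments is called $K$-subgaussian if $\|\langle y,v\rangle\|_{\psi_2}\le K(\mathbb{E}\langle y,v\rangle^2)^{1/2}$ for all $v\in\mathbb{R}^p$; a random vector in $\mathbb{C}^p$ is called $K$-subgaussian if both its real part and its imaginary part are. For matrices, $\|\cdot\|$ is the operator norm with respect to the Euclidean norm and $\|\cdot\|_\infty$ the entrywise maximum norm; for vectors, $\|\cdot\|_\infty$ is the maximum modulus of the entries. Let $K>0$ and $n,p\in\mathbb{N}$, $n,p\ge 1$. Let $x_1,\dots,x_n\in\mathbb{F}^p$ be either (d) deterministic, with $\Sigma_x:=\frac1n\sum_{k=1}^n x_kx_k^*$, or (s) i.i.d. copies of a $K$-subgaussian random vector $x$, with $\Sigma_x:=\mathbb{E}(xx^*)$. Let $e_1,\dots,e_n\in\mathbb{F}^p$ be i.i.d. copies of a $K$-subgaussian random vector $e$ with uncorrelated mean-zero entries of variance $\nu^2$;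 if $\mathbb{F}=\mathbb{C}$, the real and imaginary part of each entry of $e$ are independent. Let $x_1,\dots,x_n,e_1,\dots,e_n$ be independent. Put $y_k=x_k+e_k$, $\Sigma_y=\Sigma_x+\mathbb{E}(ee^*)$, $$C_\infty=\max_{k\le n}\|\mathbb{E}(y_ky_k^*)\|_\infty,\qquad C_{\rm op}=\max_{k\le n}\|\mathbb{E}(y_ky_k^*)\|.$$ Let $\lambda>0$, and let $\tau_1,\dots,\tau_n,\dot\tau_1,\dots,\dot\tau_n\in\mathbb{F}^p$ be independent of each other and of all $x_k,e_k$, with independent entries that are uniformly distributed on $[-\lambda,\lambda]$ (if $\mathbb{F}=\mathbb{R}$), respectively have independent real and imaginary parts uniformly distributed on $[-\lambda,\lambda]$ (if $\mathbb{F}=\mathbb{C}$). Let $\mathrm{sign}_{\mathbb{R}}(a)=1$ for $a\ge0$ and $-1$ for $a<0$, let $\mathrm{sign}_{\mathbb{C}}(z)=\mathrm{sign}_{\mathbb{R}}(\mathrm{Re}\,z)+\mathrm{i}\,\mathrm{sign}_{\mathbb{R}}(\mathrm{Im}\,z)$, both acting entrywise on vectors, and set $q_k=\mathrm{sign}_{\mathbb{F}}(y_k+\tau_k)$,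 $\dot q_k=\mathrm{sign}_{\mathbb{F}}(y_k+\dot\tau_k)$, $$\hat\Sigma_n'=\frac{\lambda^2}{n}\sum_{k=1}^n q_k\dot q_k^*,\qquad \hat\Sigma_n^\square=\tfrac12\hat\Sigma_n'+\tfrac12(\hat\Sigma_n')^*.$$ Let $t\ge0$, and suppose that $p\ge2$ or $t\ge1$. Then there are constants $B_K,C_K>0$ depending only on $K$ such that the following holds. (i) If $n\ge2$ and $\lambda^2\ge B_K\log(n)\,C_\infty$, then with probability at least $1-e^{-t}$ $$\|\hat\Sigma_n^\square-\Sigma_y\|\le C_K\left((\lambda C_{\rm op}^{1/2}+\lambda^2)\sqrt{\frac{p(\log(p)+t)}{n}}+\lambda^2\,\frac{p(\log(p)+t)}{n}\right).\qquad(*)$$ In particular, for every $b>0$ there is a constant $C_{K,b}>0$ depending only on $K$ and $b$ such that, if $n\ge 2$ and $B_K\log(n)\,C_\infty\le\lambda^2\le b\log(n)\,C_\infty$, then with probability at least $1-e^{-t}$ $$\|\hat\Sigma_n^\square-\Sigma_y\|\le C_{K,b}\left(\log(n)\sqrt{C_{\rm op}C_\infty\frac{p(\log(p)+t)}{n}}+\log(n)\,C_\infty\,\frac{p(\log(p)+t)}{n}\right).$$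 (ii) If $\|y_k\|_\infty\le M$ almost surely for each $k\in\{1,\dots,n\}$ and $\lambda\ge M$, then $(*)$ holds with probability at least $1-e^{-t}$. -/

import Mathlib

open MeasureTheory ProbabilityTheory

noncomputable section

namespace OneBitCov

/-! ### Matrices -/

/-- Operator norm of a square matrix with respect to the Euclidean norm. -/
def opNorm {𝕜 : Type*} [RCLike 𝕜] {p : ℕ} (A : Matrix (Fin p) (Fin p) 𝕜) : ℝ :=
  ‖Matrix.toEuclideanCLM (n := Fin p) (𝕜 := 𝕜) A‖

/-- Entrywise maximum norm of a square matrix. -/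
def maxNorm {𝕜 : Type*} [RCLike 𝕜] {p : ℕ} (A : Matrix (Fin p) (Fin p) 𝕜) : ℝ :=
  ⨆ i : Fin p, ⨆ j : Fin p, ‖A i j‖

/-- The rank one matrix `u v^*`. -/
def outer {𝕜 : Type*} [RCLike 𝕜] {p : ℕ} (u v : Fin p → 𝕜) : Matrix (Fin p) (Fin p) 𝕜 :=
  Matrix.vecMulVec u (star v)

/-! ### Random vectors -/

/-- The matrix `E (y y^*)`, taken entrywise. -/
def secondMoment {𝕜 : Type*} [RCLike 𝕜] {Ω : Type*} [MeasurableSpace Ω] (μ : Measure Ω) {p : ℕ}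
    (y : Ω → Fin p → 𝕜) : Matrix (Fin p) (Fin p) 𝕜 :=
  Matrix.of fun i j => ∫ ω, outer (y ω) (y ω) i j ∂μ

/-- The subgaussian norm `inf {t > 0 : E exp (|X|^2 / t^2) ≤ 2}`; it is `∞` if there is no
such `t`. -/
def psi2Norm {Ω : Type*} [MeasurableSpace Ω] (μ : Measure Ω) (X : Ω → ℝ) : ENNReal :=
  sInf {s : ENNReal | ∃ t : ℝ, 0 < t ∧ s = ENNReal.ofReal t ∧
    ∫⁻ ω, ENNReal.ofReal (Real.exp (|X ω| ^ 2 / t ^ 2)) ∂μ ≤ 2}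

/-- A real random vector with finite second moments is `K`-subgaussian if it has mean zero and
each of its one-dimensional marginals has `ψ₂`-norm at most `K` times its `L²`-norm. -/
structure IsSubgaussianReal {Ω : Type*} [MeasurableSpace Ω] (μ : Measure Ω) {p : ℕ} (K : ℝ)
    (y : Ω → Fin p → ℝ) : Prop where
  memLp : ∀ i, MemLp (fun ω => y ω i) 2 μ
  mean_zero : ∀ i, ∫ ω, y ω i ∂μ = 0
  psi2_le : ∀ v : Fin p → ℝ,
    psi2Norm μ (fun ω => ∑ i, y ω i * v i) ≤
      ENNReal.ofReal K * eLpNorm (fun ω => ∑ i, y ω i * v i) 2 μ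

/-- A random vector over `ℝ` or `ℂ` is `K`-subgaussian if its real part and its imaginary part
are (over `ℝ` the imaginary part is zero and the second condition is void). -/
def IsSubgaussian {𝕜 : Type*} [RCLike 𝕜] {Ω : Type*} [MeasurableSpace Ω] (μ : Measure Ω) {p : ℕ}
    (K : ℝ) (y : Ω → Fin p → 𝕜) : Prop :=
  IsSubgaussianReal μ K (fun ω i => RCLike.re (y ω i)) ∧
    IsSubgaussianReal μ K (fun ω i => RCLike.im (y ω i))

/-- The signals are deterministic: `x_1, …, x_n` are constant vectors and `Sx` is
`(1/n) ∑ x_k x_k^*`. -/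
def DeterministicSignal {𝕜 : Type*} [RCLike 𝕜] {Ω : Type*} {n p : ℕ}
    (x : Fin n → Ω → Fin p → 𝕜) (Sx : Matrix (Fin p) (Fin p) 𝕜) : Prop :=
  ∃ v : Fin n → Fin p → 𝕜, (∀ k, x k = fun _ => v k) ∧
    Sx = (n : 𝕜)⁻¹ • ∑ k, outer (v k) (v k)

/-- The signals are stochastic: `x_1, …, x_n` are identically distributed and `K`-subgaussian,
and `Sx` is their common second moment matrix. -/
structure StochasticSignal {𝕜 : Type*} [RCLike 𝕜] {Ω : Type*} [MeasurableSpace Ω]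
    (μ : Measure Ω) {n p : ℕ} (K : ℝ) (x : Fin n → Ω → Fin p → 𝕜)
    (Sx : Matrix (Fin p) (Fin p) 𝕜) : Prop where
  measurable : ∀ k, Measurable (x k)
  identDistrib : ∀ k l, IdentDistrib (x k) (x l) μ μ
  subgaussian : ∀ k, IsSubgaussian μ K (x k)
  cov : ∀ k, Sx = secondMoment μ (x k)

/-- The noise: identically distributed `K`-subgaussian vectors with uncorrelated mean-zero
entries of variance `ν ^ 2`, the real and imaginary part of each entry being independent
(void over `ℝ`). `Se` is their common second moment matrix. -/
structure NoiseModel {𝕜 : Type*} [RCLike 𝕜] {Ω : Type*} [MeasurableSpace Ω]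
    (μ : Measure Ω) {n p : ℕ} (K ν : ℝ) (e : Fin n → Ω → Fin p → 𝕜)
    (Se : Matrix (Fin p) (Fin p) 𝕜) : Prop where
  measurable : ∀ k, Measurable (e k)
  identDistrib : ∀ k l, IdentDistrib (e k) (e l) μ μ
  subgaussian : ∀ k, IsSubgaussian μ K (e k)
  mean_zero : ∀ k i, ∫ ω, e k ω i ∂μ = 0
  variance : ∀ k i, ∫ ω, ‖e k ω i‖ ^ 2 ∂μ = ν ^ 2
  uncorrelated : ∀ k i j, i ≠ j → ∫ ω, e k ω i * star (e k ω j) ∂μ = 0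
  indep_re_im : ∀ k i,
    IndepFun (fun ω => RCLike.re (e k ω i)) (fun ω => RCLike.im (e k ω i)) μ
  cov : ∀ k, Se = secondMoment μ (e k)

/-! ### Dithered one-bit quantization -/

/-- The uniform distribution on `[-lam, lam]`. -/
def uniformLaw (lam : ℝ) : Measure ℝ :=
  ProbabilityTheory.cond volume (Set.Icc (-lam) lam)

/-- The law of `U + V i` with `U, V` independent and uniform on `[-lam, lam]`. Over `ℝ`, where
`RCLike.I = 0`, this is the law of `U`. -/
def ditherLaw (𝕜 : Type*) [RCLike 𝕜] (lam : ℝ) : Measure 𝕜 :=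
  ((uniformLaw lam).prod (uniformLaw lam)).map
    fun z : ℝ × ℝ => (z.1 : 𝕜) + (z.2 : 𝕜) * RCLike.I

/-- The law of a dithering vector: independent entries, each distributed as `ditherLaw`. -/
def ditherVecLaw (𝕜 : Type*) [RCLike 𝕜] (p : ℕ) (lam : ℝ) : Measure (Fin p → 𝕜) :=
  Measure.pi fun _ => ditherLaw 𝕜 lam

/-- The real sign function, with value `1` at `0`. -/
def signReal (a : ℝ) : ℝ := if 0 ≤ a then 1 else -1

/-- The sign function of `ℝ` or `ℂ`: `sign (re z) + i sign (im z)`; over `ℝ`, where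
`RCLike.I = 0`, this is the real sign function. -/
def signF {𝕜 : Type*} [RCLike 𝕜] (z : 𝕜) : 𝕜 :=
  (signReal (RCLike.re z) : 𝕜) + (signReal (RCLike.im z) : 𝕜) * RCLike.I

/-- The quantized sample: the sign of `y + τ`, entrywise. -/
def quantize {𝕜 : Type*} [RCLike 𝕜] {p : ℕ} (y τ : Fin p → 𝕜) : Fin p → 𝕜 :=
  fun i => signF (y i + τ i)

/-- The asymmetric estimator `(lam ^ 2 / n) ∑ q_k q'_k^*` from samples `y` and dithers `τ`, `τ'`. -/
def asymEstimator {𝕜 : Type*} [RCLike 𝕜] {n p : ℕ} (lam : ℝ) (y τ τ' : Fin n → Fin p → 𝕜) :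
    Matrix (Fin p) (Fin p) 𝕜 :=
  ((lam ^ 2 / n : ℝ) : 𝕜) • ∑ k, outer (quantize (y k) (τ k)) (quantize (y k) (τ' k))

/-- The covariance estimator: the Hermitian part of the asymmetric one. -/
def estimator {𝕜 : Type*} [RCLike 𝕜] {n p : ℕ} (lam : ℝ) (y τ τ' : Fin n → Fin p → 𝕜) :
    Matrix (Fin p) (Fin p) 𝕜 :=
  ((1 / 2 : ℝ) : 𝕜) • asymEstimator lam y τ τ' +
    ((1 / 2 : ℝ) : 𝕜) • (asymEstimator lam y τ τ').conjTranspose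

/-- `max_k ‖E (y_k y_k^*)‖_∞`. -/
def Cinf {𝕜 : Type*} [RCLike 𝕜] {Ω : Type*} [MeasurableSpace Ω] (μ : Measure Ω) {n p : ℕ}
    (y : Fin n → Ω → Fin p → 𝕜) : ℝ :=
  ⨆ k : Fin n, maxNorm (secondMoment μ (y k))

/-- `max_k ‖E (y_k y_k^*)‖`. -/
def Cop {𝕜 : Type*} [RCLike 𝕜] {Ω : Type*} [MeasurableSpace Ω] (μ : Measure Ω) {n p : ℕ}
    (y : Fin n → Ω → Fin p → 𝕜) : ℝ :=
  ⨆ k : Fin n, opNorm (secondMoment μ (y k))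

/-- The observations `y_k = x_k + e_k`. -/
def obs {𝕜 : Type*} [RCLike 𝕜] {Ω : Type*} {n p : ℕ} (x e : Fin n → Ω → Fin p → 𝕜) :
    Fin n → Ω → Fin p → 𝕜 :=
  fun k ω => x k ω + e k ω

/-- The random error `‖Σ̂ - S‖` of the estimator at the outcome `ω`. -/
def estError {𝕜 : Type*} [RCLike 𝕜] {Ω : Type*} {n p : ℕ} (lam : ℝ)
    (y τ τ' : Fin n → Ω → Fin p → 𝕜) (S : Matrix (Fin p) (Fin p) 𝕜) (ω : Ω) : ℝ :=
  opNorm (estimator lam (fun k => y k ω) (fun k => τ k ω) (fun k => τ' k ω) - S)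

/-- `p (log p + t) / n`. -/
def rate (n p : ℕ) (t : ℝ) : ℝ := p * (Real.log p + t) / n

end OneBitCov

end

/-!
Over the dithers, `lam • q` and `lam • q'` are unbiased for the truncation of `y` to `[-lam, lam]`
and conditionally independent, so the estimator is an average of independent Hermitian matrices
whose mean is the second moment of the truncated samples. Two errors remain. The truncation bias
vanishes when `y` is bounded by `lam`; in general, Gaussian tails on the scale
`lam / √(2 log n)` make the second moment of the truncated part `O(p lam² / n)`. The deviation is
controlled by a matrix Bernstein inequality: each summand has norm at most `2 p lam²`, and the mean
of its square is at most `4 p lam² (Cop + O(p lam² / n) + lam²)` because `‖q‖²` is at most `2 p`.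
Matrix Bernstein follows from the Golden–Thompson inequality by peeling off one independent
summand at a time; Golden–Thompson itself comes from the Lie product formula and the trace
inequality `|tr ((AB)^(2^k))| ≤ tr (A^(2^k) B^(2^k))` for positive semidefinite matrices.
-/

namespace OneBitCov

section LieProduct

open NormedSpace Filter Topology

variable {𝔸 : Type*} [NormedRing 𝔸]

theorem norm_exp_le_exp_norm [NormOneClass 𝔸] (𝕂 : Type*) [RCLike 𝕂] [NormedAlgebra 𝕂 𝔸]
    (x : 𝔸) : ‖exp x‖ ≤ Real.exp ‖x‖ := by
  have hsum : HasSum (fun n : ℕ => ‖x‖ ^ n / (n.factorial : ℝ)) (Real.exp ‖x‖) := by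
    simpa only [Real.exp_eq_exp_ℝ] using expSeries_div_hasSum_exp (𝔸 := ℝ) ‖x‖
  rw [exp_eq_tsum 𝕂]
  refine tsum_of_norm_bounded hsum fun n => ?_
  rw [norm_smul, norm_inv, RCLike.norm_natCast, div_eq_inv_mul]
  gcongr
  exact norm_pow_le x n

theorem norm_pow_succ_sub_pow_succ_le {a b : 𝔸} {M : ℝ} (ha : ‖a‖ ≤ M) (hb : ‖b‖ ≤ M) (n : ℕ) :
    ‖a ^ (n + 1) - b ^ (n + 1)‖ ≤ (n + 1) * M ^ n * ‖a - b‖ := by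
  have hM : 0 ≤ M := (norm_nonneg a).trans ha
  induction n with
  | zero => simp
  | succ n ih =>
    have hbn : ‖b ^ (n + 1)‖ ≤ M ^ (n + 1) :=
      (norm_pow_le' b n.succ_pos).trans (pow_le_pow_left₀ (norm_nonneg _) hb _)
    calc ‖a ^ (n + 1 + 1) - b ^ (n + 1 + 1)‖
        = ‖a * (a ^ (n + 1) - b ^ (n + 1)) + (a - b) * b ^ (n + 1)‖ := by
          rw [pow_succ' a, pow_succ' b]; noncomm_ring
      _ ≤ ‖a‖ * ‖a ^ (n + 1) - b ^ (n + 1)‖ + ‖a - b‖ * ‖b ^ (n + 1)‖ :=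
          (norm_add_le _ _).trans (add_le_add (norm_mul_le _ _) (norm_mul_le _ _))
      _ ≤ M * ((n + 1) * M ^ n * ‖a - b‖) + ‖a - b‖ * M ^ (n + 1) := by gcongr
      _ = _ := by push_cast; ring

variable {𝕂 : Type*} [RCLike 𝕂] [NormedAlgebra 𝕂 𝔸]

theorem norm_exp_smul_mul_exp_smul_pow_sub_le [NormOneClass 𝔸] (a b : 𝔸) (n : ℕ) :
    ‖(exp ((n : 𝕂)⁻¹ • a) * exp ((n : 𝕂)⁻¹ • b)) ^ n - exp ((n : 𝕂)⁻¹ • (a + b)) ^ n‖ ≤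
      Real.exp (‖a‖ + ‖b‖) *
        (n * ‖exp ((n : 𝕂)⁻¹ • a) * exp ((n : 𝕂)⁻¹ • b) - exp ((n : 𝕂)⁻¹ • (a + b))‖) := by
  rcases n with _ | m
  · simp
  set s : 𝕂 := ((m + 1 : ℕ) : 𝕂)⁻¹
  have hs : ‖s‖ = ((m : ℝ) + 1)⁻¹ := by simp only [s, norm_inv, RCLike.norm_natCast]; push_cast; rfl
  have hexp : ∀ x : 𝔸, ‖exp (s • x)‖ ≤ Real.exp (‖s‖ * ‖x‖) := fun x =>
    (norm_exp_le_exp_norm 𝕂 _).trans_eq (by rw [norm_smul])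
  have hprod : ‖exp (s • a) * exp (s • b)‖ ≤ Real.exp (‖s‖ * (‖a‖ + ‖b‖)) := by
    rw [mul_add, Real.exp_add]
    exact norm_mul_le_of_le (hexp a) (hexp b)
  have hsum : ‖exp (s • (a + b))‖ ≤ Real.exp (‖s‖ * (‖a‖ + ‖b‖)) :=
    (hexp _).trans (by gcongr; exact norm_add_le a b)
  refine (norm_pow_succ_sub_pow_succ_le hprod hsum m).trans ?_
  rw [Nat.cast_succ, ← Real.exp_nat_mul, mul_comm ((m : ℝ) + 1), mul_assoc]
  gcongr
  rw [hs, ← mul_assoc, ← div_eq_mul_inv]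
  exact mul_le_of_le_one_left (by positivity) ((div_le_one (by positivity)).2 (by linarith))

variable [CompleteSpace 𝔸]

theorem isLittleO_exp_smul_mul_exp_smul_sub (a b : 𝔸) :
    (fun t : 𝕂 => exp (t • a) * exp (t • b) - exp (t • (a + b))) =o[𝓝 0] fun t => t := by
  have hderiv := ((hasDerivAt_exp_smul_const a (0 : 𝕂)).mul
    (hasDerivAt_exp_smul_const b (0 : 𝕂))).sub (hasDerivAt_exp_smul_const (a + b) (0 : 𝕂))
  simpa using hasDerivAt_iff_isLittleO.1 (hderiv.congr_deriv (g' := 0) (by simp))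

theorem exp_inv_smul_pow (a : 𝔸) {n : ℕ} (hn : n ≠ 0) : exp ((n : 𝕂)⁻¹ • a) ^ n = exp a := by
  let _ : NormedAlgebra ℚ 𝔸 := NormedAlgebra.restrictScalars ℚ 𝕂 𝔸
  rw [← exp_nsmul, ← Nat.cast_smul_eq_nsmul 𝕂, smul_inv_smul₀ (Nat.cast_ne_zero.2 hn)]

variable (𝕂) in
theorem tendsto_exp_mul_exp_pow [NormOneClass 𝔸] (a b : 𝔸) :
    Tendsto (fun n : ℕ => (exp ((n : 𝕂)⁻¹ • a) * exp ((n : 𝕂)⁻¹ • b)) ^ n) atTop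
      (𝓝 (exp (a + b))) := by
  have hlim : Tendsto (fun n : ℕ => n * ‖exp ((n : 𝕂)⁻¹ • a) * exp ((n : 𝕂)⁻¹ • b) -
      exp ((n : 𝕂)⁻¹ • (a + b))‖) atTop (𝓝 0) := by
    refine ((isLittleO_exp_smul_mul_exp_smul_sub (𝕂 := 𝕂) a b).comp_tendsto
      (tendsto_inv_atTop_nhds_zero_nat (𝕜 := 𝕂))).norm_norm.tendsto_div_nhds_zero.congr fun n => ?_
    simp [div_inv_eq_mul, mul_comm]
  have hbound := hlim.const_mul (Real.exp (‖a‖ + ‖b‖))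
  rw [mul_zero] at hbound
  rw [tendsto_iff_norm_sub_tendsto_zero]
  refine squeeze_zero' (Eventually.of_forall fun _ => norm_nonneg _) ?_ hbound
  filter_upwards [eventually_ne_atTop 0] with n hn
  simpa only [exp_inv_smul_pow (𝕂 := 𝕂) (a + b) hn] using
    norm_exp_smul_mul_exp_smul_pow_sub_le (𝕂 := 𝕂) a b n

end LieProduct

section GoldenThompson

open Matrix NormedSpace Filter Topology
open scoped Matrix.Norms.L2Operator

variable {𝕜 : Type*} [RCLike 𝕜] {m : Type*} [Fintype m]

theorem re_trace_mul_conjTranspose (A : Matrix m m 𝕜) :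
    RCLike.re (A * Aᴴ).trace = ∑ i, ∑ j, ‖A i j‖ ^ 2 := by
  simp only [trace, diag_apply, mul_apply, conjTranspose_apply, map_sum, RCLike.star_def,
    RCLike.mul_conj]
  norm_cast

theorem norm_trace_mul_le (A B : Matrix m m 𝕜) :
    ‖(A * B).trace‖ ≤ (RCLike.re (A * Aᴴ).trace + RCLike.re (B * Bᴴ).trace) / 2 := by
  rw [re_trace_mul_conjTranspose, re_trace_mul_conjTranspose,
    Finset.sum_comm (f := fun i j => ‖B i j‖ ^ 2)]
  simp only [← Finset.sum_add_distrib, Finset.sum_div, trace, diag_apply, mul_apply]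
  refine norm_sum_le_of_le _ fun i _ => norm_sum_le_of_le _ fun j _ => ?_
  rw [norm_mul]
  linarith [two_mul_le_add_sq ‖A i j‖ ‖B j i‖]

variable [DecidableEq m]

theorem trace_mul_pow_comm {R : Type*} [CommSemiring R] (A B : Matrix m m R) (k : ℕ) :
    ((A * B) ^ k).trace = ((B * A) ^ k).trace := by
  cases k with
  | zero => simp
  | succ k =>
    have hAB : SemiconjBy A ((B * A) ^ k) ((A * B) ^ k) :=
      SemiconjBy.pow_right (by simp only [SemiconjBy, mul_assoc]) k
    rw [pow_succ, ← mul_assoc, trace_mul_comm, ← hAB.eq, ← mul_assoc, ← pow_succ']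

theorem norm_trace_mul_pow_two_pow_succ_le {k : ℕ}
    (hk : ∀ X : Matrix m m 𝕜, ‖(X ^ 2 ^ (k + 1)).trace‖ ≤ RCLike.re ((X * Xᴴ) ^ 2 ^ k).trace)
    {P Q : Matrix m m 𝕜} (hP : P.IsHermitian) (hQ : Q.IsHermitian) :
    ‖((P * Q) ^ 2 ^ (k + 1)).trace‖ ≤ ‖((P ^ 2 * Q ^ 2) ^ 2 ^ k).trace‖ := by
  have hPQ : P * Q * (P * Q)ᴴ = P * (Q * Q * P) := by
    rw [conjTranspose_mul, hP.eq, hQ.eq]; simp only [mul_assoc]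
  refine (hk (P * Q)).trans ((RCLike.re_le_norm _).trans_eq ?_)
  rw [hPQ, trace_mul_pow_comm, trace_mul_pow_comm (P ^ 2)]
  simp only [pow_two, mul_assoc]

-- The two inequalities feed each other: the first, applied to `P * Q`, passes the second from
-- `k` to `k + 1`, and the second, applied to `X * Xᴴ` and `Xᴴ * X`, does the same for the first.
theorem norm_trace_pow_two_pow_le (k : ℕ) :
    (∀ X : Matrix m m 𝕜, ‖(X ^ 2 ^ (k + 1)).trace‖ ≤ RCLike.re ((X * Xᴴ) ^ 2 ^ k).trace) ∧
    (∀ P Q : Matrix m m 𝕜, P.IsHermitian → Q.IsHermitian →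
      ‖((P * Q) ^ 2 ^ k).trace‖ ≤ ‖(P ^ 2 ^ k * Q ^ 2 ^ k).trace‖) := by
  induction k with
  | zero =>
    refine ⟨fun X => ?_, fun P Q _ _ => by simp⟩
    simpa [pow_two, add_self_div_two] using norm_trace_mul_le X X
  | succ k ih =>
    obtain ⟨ihX, ihPQ⟩ := ih
    refine ⟨fun X => ?_, fun P Q hP hQ => ?_⟩
    · have hP : (X * Xᴴ).IsHermitian := isHermitian_mul_conjTranspose_self X
      have hQ : (Xᴴ * X).IsHermitian := isHermitian_conjTranspose_mul_self X
      calc ‖(X ^ 2 ^ (k + 1 + 1)).trace‖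
          ≤ RCLike.re ((X ^ 2 * (X ^ 2)ᴴ) ^ 2 ^ k).trace := by
            rw [pow_succ' 2 (k + 1), pow_mul]
            exact ihX (X ^ 2)
        _ = RCLike.re ((X * Xᴴ * (Xᴴ * X)) ^ 2 ^ k).trace := by
            rw [pow_two, conjTranspose_mul, mul_assoc, trace_mul_pow_comm]; simp only [mul_assoc]
        _ ≤ ‖((X * Xᴴ) ^ 2 ^ k * (Xᴴ * X) ^ 2 ^ k).trace‖ :=
            (RCLike.re_le_norm _).trans (ihPQ _ _ hP hQ)
        _ ≤ _ := norm_trace_mul_le _ _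
        _ = RCLike.re ((X * Xᴴ) ^ 2 ^ (k + 1)).trace := by
            rw [(hP.pow _).eq, (hQ.pow _).eq, ← pow_add, ← pow_add, ← two_mul, ← pow_succ',
              trace_mul_pow_comm Xᴴ X, add_self_div_two]
    · have hsq := ihPQ (P ^ 2) (Q ^ 2) (hP.pow 2) (hQ.pow 2)
      rw [← pow_mul, ← pow_mul, ← pow_succ'] at hsq
      exact (norm_trace_mul_pow_two_pow_succ_le ihX hP hQ).trans hsq

theorem norm_trace_exp_add_le [Nonempty m] {A B : Matrix m m 𝕜} (hA : A.IsHermitian)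
    (hB : B.IsHermitian) : ‖(exp (A + B)).trace‖ ≤ ‖(exp A * exp B).trace‖ := by
  have hlim := (tendsto_exp_mul_exp_pow 𝕜 A B).comp (tendsto_pow_atTop_atTop_of_one_lt one_lt_two)
  refine le_of_tendsto ((continuous_id.matrix_trace.norm.tendsto _).comp hlim)
    (Eventually.of_forall fun k => ?_)
  have hherm : ∀ M : Matrix m m 𝕜, M.IsHermitian →
      (exp (((2 ^ k : ℕ) : 𝕜)⁻¹ • M)).IsHermitian := fun M hM => by
    refine IsHermitian.exp ?_
    rw [IsHermitian, conjTranspose_smul, hM.eq]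
    simp
  have hk : 2 ^ k ≠ 0 := by positivity
  simpa only [Function.comp, id, exp_inv_smul_pow (𝕂 := 𝕜) _ hk] using
    (norm_trace_pow_two_pow_le k).2 _ _ (hherm A hA) (hherm B hB)

end GoldenThompson

section HermitianExponential

open Matrix NormedSpace
open scoped Matrix.Norms.L2Operator MatrixOrder ComplexOrder

variable {𝕜 : Type*} [RCLike 𝕜] {m : Type*} [Fintype m] [DecidableEq m] {A B C : Matrix m m 𝕜}

/-- The real normed algebra structure on matrices over `𝕜`, for the `ℓ²` operator norm. It extends
the entrywise scalar action, to which `NormedAlgebra.restrictScalars` is not reducibly equal. -/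
@[reducible] noncomputable def matrixNormedAlgebraReal : NormedAlgebra ℝ (Matrix m m 𝕜) where
  norm_smul_le r A := by rw [← algebraMap_smul 𝕜 r A, norm_smul, norm_algebraMap']

attribute [local instance] matrixNormedAlgebraReal

theorem trace_cfc (hA : A.IsHermitian) (f : ℝ → ℝ) :
    (cfc f A).trace = ∑ i, (f (hA.eigenvalues i) : 𝕜) := by
  rw [hA.cfc_eq, IsHermitian.cfc, Unitary.conjStarAlgAut_apply, trace_mul_comm, ← mul_assoc,
    Unitary.coe_star_mul_self, one_mul, trace_diagonal]
  rfl

theorem re_trace_exp_nonneg (hA : A.IsHermitian) : 0 ≤ RCLike.re (exp A).trace :=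
  (RCLike.nonneg_iff.1 (nonneg_iff_posSemidef.1 hA.isSelfAdjoint.exp_nonneg).trace_nonneg).1

theorem exp_le_re_trace_exp_of_mem_spectrum (hA : A.IsHermitian) {x : ℝ}
    (hx : x ∈ spectrum ℝ A) : Real.exp x ≤ RCLike.re (exp A).trace := by
  rw [hA.spectrum_real_eq_range_eigenvalues] at hx
  obtain ⟨i, rfl⟩ := hx
  rw [← CFC.real_exp_eq_normedSpace_exp hA.isSelfAdjoint, trace_cfc hA, map_sum]
  simp only [RCLike.ofReal_re]
  exact Finset.single_le_sum (f := fun i => Real.exp (hA.eigenvalues i))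
    (fun _ _ => (Real.exp_pos _).le) (Finset.mem_univ i)

theorem exp_norm_le_re_trace_exp_add_re_trace_exp_neg [Nonempty m] (hA : A.IsHermitian) :
    Real.exp ‖A‖ ≤ RCLike.re (exp A).trace + RCLike.re (exp (-A)).trace := by
  obtain ⟨x, hx, hxA⟩ := (IsometricContinuousFunctionalCalculus.isGreatest_norm_spectrum (𝕜 := ℝ)
    A hA.isSelfAdjoint).1
  have hneg : -x ∈ spectrum ℝ (-A) := by simpa [← spectrum.neg_eq] using hx
  have h := exp_le_re_trace_exp_of_mem_spectrum hA hx
  have h' := exp_le_re_trace_exp_of_mem_spectrum hA.neg hneg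
  simp only [← hxA, Real.norm_eq_abs]
  rcases abs_cases x with ⟨hx, -⟩ | ⟨hx, -⟩ <;> rw [hx]
  · linarith [re_trace_exp_nonneg hA.neg]
  · linarith [re_trace_exp_nonneg hA]

theorem exp_le_one_add_add_mul_self (hA : A.IsHermitian) (h : ‖A‖ ≤ 1) :
    exp A ≤ 1 + A + A * A := by
  have hsa : IsSelfAdjoint A := hA.isSelfAdjoint
  have hpoly : cfc (fun x : ℝ => 1 + x + x * x) A = 1 + A + A * A := by
    rw [cfc_add .., cfc_add .., cfc_mul .., cfc_id' .., cfc_const_one ..]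
  rw [← hpoly, ← CFC.real_exp_eq_normedSpace_exp hsa, cfc_le_iff ..]
  intro x hx
  have hx1 : |x| ≤ 1 :=
    (IsometricContinuousFunctionalCalculus.norm_spectrum_le (𝕜 := ℝ) A hx hsa).trans h
  linarith [(abs_le.1 (Real.abs_exp_sub_one_sub_id_le hx1)).2]

omit [DecidableEq m] in
theorem trace_mul_nonneg (hA : 0 ≤ A) (hB : 0 ≤ B) : 0 ≤ (A * B).trace := by
  classical
  obtain ⟨R, hR⟩ := CStarAlgebra.nonneg_iff_eq_star_mul_self.1 hA
  rw [hR, mul_assoc, trace_mul_comm, star_eq_conjTranspose]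
  exact ((nonneg_iff_posSemidef.1 hB).mul_mul_conjTranspose_same R).trace_nonneg

omit [DecidableEq m] in
theorem re_trace_mul_le_re_trace_mul (hA : 0 ≤ A) (h : B ≤ C) :
    RCLike.re (A * B).trace ≤ RCLike.re (A * C).trace := by
  have hpos := (RCLike.nonneg_iff.1 (trace_mul_nonneg hA (sub_nonneg.2 h))).1
  rwa [mul_sub, trace_sub, map_sub, sub_nonneg] at hpos

theorem re_trace_exp_add_le [Nonempty m] (hA : A.IsHermitian) (hB : B.IsHermitian) :
    RCLike.re (exp (A + B)).trace ≤ RCLike.re (exp A * exp B).trace := by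
  have hpos := trace_mul_nonneg hA.isSelfAdjoint.exp_nonneg hB.isSelfAdjoint.exp_nonneg
  refine (RCLike.re_le_norm _).trans ((norm_trace_exp_add_le hA hB).trans_eq ?_)
  rw [← RCLike.ofReal_re (K := 𝕜) ‖_‖, RCLike.norm_of_nonneg' hpos]

end HermitianExponential

section MatrixBernstein

open Matrix NormedSpace
open scoped Matrix.Norms.L2Operator MatrixOrder ComplexOrder

variable {𝕜 : Type*} [RCLike 𝕜] {m : Type*}

/-- The product σ-algebra on matrices. -/
@[reducible] def matrixMeasurableSpace (m 𝕜 : Type*) [RCLike 𝕜] : MeasurableSpace (Matrix m m 𝕜) :=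
  inferInstanceAs (MeasurableSpace (m → m → 𝕜))

attribute [local instance] matrixMeasurableSpace

theorem matrix_borelSpace [Finite m] : BorelSpace (Matrix m m 𝕜) :=
  inferInstanceAs (BorelSpace (m → m → 𝕜))

theorem matrix_secondCountableTopology [Finite m] :
    SecondCountableTopology (Matrix m m 𝕜) :=
  inferInstanceAs (SecondCountableTopology (m → m → 𝕜))

theorem matrix_orderClosedTopology [Finite m] : OrderClosedTopology (Matrix m m 𝕜) where
  isClosed_le' := by
    have := Fintype.ofFinite m
    refine isClosed_le_of_isClosed_nonneg ?_
    simp only [nonneg_iff_posSemidef, posSemidef_iff_dotProduct_mulVec, IsHermitian,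
      Set.ofPred_and, Set.ofPred_forall]
    exact (isClosed_eq (by fun_prop) continuous_id).inter
      (isClosed_iInter fun v => isClosed_le continuous_const (by fun_prop))

attribute [local instance] matrix_borelSpace matrix_secondCountableTopology
  matrix_orderClosedTopology

variable [Fintype m] [DecidableEq m]

attribute [local instance] matrixNormedAlgebraReal

variable {Ω : Type*} [MeasurableSpace Ω] {μ : Measure Ω} [IsProbabilityMeasure μ]
  {S X : Ω → Matrix m m 𝕜} {r v : ℝ}

theorem measurable_exp : Measurable (exp : Matrix m m 𝕜 → Matrix m m 𝕜) := by
  let _ : NormedAlgebra ℚ (Matrix m m 𝕜) := NormedAlgebra.restrictScalars ℚ ℝ _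
  exact exp_continuous.measurable

theorem integrable_of_norm_le (hX : Measurable X) (hbd : ∀ ω, ‖X ω‖ ≤ r) : Integrable X μ :=
  .of_bound hX.aestronglyMeasurable r (.of_forall hbd)

theorem integrable_exp_of_norm_le [Nonempty m] (hX : Measurable X) (hbd : ∀ ω, ‖X ω‖ ≤ r) :
    Integrable (fun ω => exp (X ω)) μ :=
  integrable_of_norm_le (measurable_exp.comp hX) fun ω =>
    (norm_exp_le_exp_norm 𝕜 _).trans (Real.exp_le_exp.2 (hbd ω))

theorem integral_exp_le [Nonempty m] (hX : Measurable X) (hherm : ∀ ω, (X ω).IsHermitian)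
    (hbd : ∀ ω, ‖X ω‖ ≤ 1) (hmean : ∫ ω, X ω ∂μ = 0) (hvar : ∫ ω, X ω * X ω ∂μ ≤ v • 1) :
    ∫ ω, exp (X ω) ∂μ ≤ (1 + v) • (1 : Matrix m m 𝕜) := by
  have hXint : Integrable X μ := integrable_of_norm_le hX hbd
  have hXX : Integrable (fun ω => X ω * X ω) μ :=
    integrable_of_norm_le (hX.mul hX) fun ω =>
      (norm_mul_le _ _).trans (mul_le_one₀ (hbd ω) (norm_nonneg _) (hbd ω))
  calc ∫ ω, exp (X ω) ∂μ
      ≤ ∫ ω, (1 + X ω + X ω * X ω) ∂μ :=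
        integral_mono (integrable_exp_of_norm_le hX hbd) (((integrable_const 1).add hXint).add hXX)
          fun ω => exp_le_one_add_add_mul_self (hherm ω) (hbd ω)
    _ = 1 + ∫ ω, X ω * X ω ∂μ := by
        rw [integral_add (f := fun ω => 1 + X ω) ((integrable_const 1).add hXint) hXX,
          integral_add (integrable_const 1) hXint, hmean]
        simp
    _ ≤ (1 + v) • (1 : Matrix m m 𝕜) := by
        rw [add_smul, one_smul]
        gcongr

/-- The real part of the trace, as a continuous linear functional. -/
noncomputable def reTrace (m 𝕜 : Type*) [RCLike 𝕜] [Fintype m] [DecidableEq m] :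
    Matrix m m 𝕜 →L[ℝ] ℝ :=
  RCLike.reCLM.comp (traceLinearMap m ℝ 𝕜).toContinuousLinearMap

theorem reTrace_apply (A : Matrix m m 𝕜) : reTrace m 𝕜 A = RCLike.re A.trace := rfl

theorem integral_reTrace_exp_add_le [Nonempty m] (hS : Measurable S) (hX : Measurable X)
    (hind : IndepFun S X μ) (hSherm : ∀ ω, (S ω).IsHermitian) (hherm : ∀ ω, (X ω).IsHermitian)
    (hSbd : ∀ ω, ‖S ω‖ ≤ r) (hbd : ∀ ω, ‖X ω‖ ≤ 1) (hmean : ∫ ω, X ω ∂μ = 0)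
    (hvar : ∫ ω, X ω * X ω ∂μ ≤ v • 1) :
    ∫ ω, reTrace m 𝕜 (exp (S ω + X ω)) ∂μ ≤ (1 + v) * ∫ ω, reTrace m 𝕜 (exp (S ω)) ∂μ := by
  let B : Matrix m m 𝕜 →L[ℝ] Matrix m m 𝕜 →L[ℝ] ℝ :=
    (reTrace m 𝕜).compL ℝ _ _ _ ∘L ContinuousLinearMap.mul ℝ _
  have hexpS : Integrable (fun ω => exp (S ω)) μ := integrable_exp_of_norm_le hS hSbd
  have hexpX : Integrable (fun ω => exp (X ω)) μ := integrable_exp_of_norm_le hX hbd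
  have hexpSX : Integrable (fun ω => exp (S ω + X ω)) μ :=
    integrable_exp_of_norm_le (hS.add hX) fun ω => norm_add_le_of_le (hSbd ω) (hbd ω)
  have hexpind : IndepFun (fun ω => exp (S ω)) (fun ω => exp (X ω)) μ :=
    hind.comp measurable_exp measurable_exp
  have hnonneg : 0 ≤ ∫ ω, exp (S ω) ∂μ :=
    integral_nonneg fun ω => (hSherm ω).isSelfAdjoint.exp_nonneg
  calc ∫ ω, reTrace m 𝕜 (exp (S ω + X ω)) ∂μ
      ≤ ∫ ω, B (exp (S ω)) (exp (X ω)) ∂μ :=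
        integral_mono ((reTrace m 𝕜).integrable_comp hexpSX)
          (hexpind.integrable_bilin hexpS hexpX B)
          fun ω => re_trace_exp_add_le (hSherm ω) (hherm ω)
    _ = reTrace m 𝕜 ((∫ ω, exp (S ω) ∂μ) * ∫ ω, exp (X ω) ∂μ) :=
        hexpind.integral_bilin hexpS hexpX B
    _ ≤ reTrace m 𝕜 ((∫ ω, exp (S ω) ∂μ) * (1 + v) • 1) :=
        re_trace_mul_le_re_trace_mul hnonneg (integral_exp_le hX hherm hbd hmean hvar)
    _ = (1 + v) * ∫ ω, reTrace m 𝕜 (exp (S ω)) ∂μ := by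
        rw [mul_smul_comm, mul_one, map_smul, smul_eq_mul,
          (reTrace m 𝕜).integral_comp_comm hexpS]

variable {ι : Type*} {Y : ι → Ω → Matrix m m 𝕜} {w : ι → ℝ}

theorem integral_reTrace_exp_sum_le [Nonempty m] (hY : ∀ k, Measurable (Y k))
    (hind : iIndepFun Y μ) (hherm : ∀ k ω, (Y k ω).IsHermitian) (hbd : ∀ k ω, ‖Y k ω‖ ≤ 1)
    (hmean : ∀ k, ∫ ω, Y k ω ∂μ = 0) (hvar : ∀ k, ∫ ω, Y k ω * Y k ω ∂μ ≤ w k • 1)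
    (s : Finset ι) :
    ∫ ω, reTrace m 𝕜 (exp (∑ k ∈ s, Y k ω)) ∂μ ≤ Real.exp (∑ k ∈ s, w k) * Fintype.card m := by
  classical
  induction s using Finset.induction_on with
  | empty => simp [reTrace_apply]
  | insert a s ha ih =>
    have hSmeas : Measurable fun ω => ∑ k ∈ s, Y k ω := Finset.measurable_fun_sum _ fun k _ => hY k
    have hSind : IndepFun (fun ω => ∑ k ∈ s, Y k ω) (Y a) μ := by
      simpa only [Finset.sum_fn] using hind.indepFun_finsetSum_of_notMem hY ha
    have hSherm : ∀ ω, (∑ k ∈ s, Y k ω).IsHermitian := fun ω =>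
      isSelfAdjoint_sum _ fun k _ => hherm k ω
    have hSbd : ∀ ω, ‖∑ k ∈ s, Y k ω‖ ≤ ∑ _k ∈ s, (1 : ℝ) := fun ω =>
      norm_sum_le_of_le _ fun k _ => hbd k ω
    have hnonneg : 0 ≤ ∫ ω, reTrace m 𝕜 (exp (∑ k ∈ s, Y k ω)) ∂μ :=
      integral_nonneg fun ω => re_trace_exp_nonneg (hSherm ω)
    simp only [Finset.sum_insert ha, add_comm (Y a _)]
    calc ∫ ω, reTrace m 𝕜 (exp (∑ k ∈ s, Y k ω + Y a ω)) ∂μ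
        ≤ (1 + w a) * ∫ ω, reTrace m 𝕜 (exp (∑ k ∈ s, Y k ω)) ∂μ :=
          integral_reTrace_exp_add_le hSmeas (hY a) hSind hSherm (hherm a) hSbd (hbd a) (hmean a)
            (hvar a)
      _ ≤ Real.exp (w a) * (Real.exp (∑ k ∈ s, w k) * Fintype.card m) := by
          gcongr
          linarith [Real.add_one_le_exp (w a)]
      _ = Real.exp (w a + ∑ k ∈ s, w k) * Fintype.card m := by rw [Real.exp_add, mul_assoc]

variable [Fintype ι]

theorem integral_exp_norm_sum_le [Nonempty m] (hY : ∀ k, Measurable (Y k)) (hind : iIndepFun Y μ)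
    (hherm : ∀ k ω, (Y k ω).IsHermitian) (hbd : ∀ k ω, ‖Y k ω‖ ≤ 1)
    (hmean : ∀ k, ∫ ω, Y k ω ∂μ = 0) (hvar : ∀ k, ∫ ω, Y k ω * Y k ω ∂μ ≤ w k • 1) :
    Integrable (fun ω => Real.exp ‖∑ k, Y k ω‖) μ ∧
      ∫ ω, Real.exp ‖∑ k, Y k ω‖ ∂μ ≤ 2 * Fintype.card m * Real.exp (∑ k, w k) := by
  have hSmeas : Measurable fun ω => ∑ k, Y k ω := Finset.measurable_fun_sum _ fun k _ => hY k
  have hSherm : ∀ ω, (∑ k, Y k ω).IsHermitian := fun ω => isSelfAdjoint_sum _ fun k _ => hherm k ω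
  have hSbd : ∀ ω, ‖∑ k, Y k ω‖ ≤ ∑ _k : ι, (1 : ℝ) := fun ω =>
    norm_sum_le_of_le _ fun k _ => hbd k ω
  have hint : Integrable (fun ω => Real.exp ‖∑ k, Y k ω‖) μ :=
    .of_bound hSmeas.norm.exp.aestronglyMeasurable (Real.exp (∑ _k : ι, (1 : ℝ)))
      (.of_forall fun ω => by simpa using hSbd ω)
  have hpos : Integrable (fun ω => reTrace m 𝕜 (exp (∑ k, Y k ω))) μ :=
    (reTrace m 𝕜).integrable_comp (integrable_exp_of_norm_le hSmeas hSbd)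
  have hneg : Integrable (fun ω => reTrace m 𝕜 (exp (-∑ k, Y k ω))) μ :=
    (reTrace m 𝕜).integrable_comp
      (integrable_exp_of_norm_le hSmeas.neg fun ω => (norm_neg _).trans_le (hSbd ω))
  have hbound := integral_reTrace_exp_sum_le hY hind hherm hbd hmean hvar Finset.univ
  have hbound_neg := integral_reTrace_exp_sum_le (Y := fun k ω => -Y k ω) (μ := μ) (w := w)
    (fun k => (hY k).neg) (hind.comp (fun _ A => -A) fun _ => measurable_neg)
    (fun k ω => (hherm k ω).neg) (fun k ω => (norm_neg _).trans_le (hbd k ω))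
    (fun k => by rw [integral_neg, hmean, neg_zero]) (fun k => by simpa using hvar k) Finset.univ
  simp only [Finset.sum_neg_distrib] at hbound_neg
  refine ⟨hint, ?_⟩
  calc ∫ ω, Real.exp ‖∑ k, Y k ω‖ ∂μ
      ≤ ∫ ω, (reTrace m 𝕜 (exp (∑ k, Y k ω)) + reTrace m 𝕜 (exp (-∑ k, Y k ω))) ∂μ :=
        integral_mono hint (hpos.add hneg) fun ω =>
          exp_norm_le_re_trace_exp_add_re_trace_exp_neg (hSherm ω)
    _ ≤ 2 * Fintype.card m * Real.exp (∑ k, w k) := by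
        rw [integral_add hpos hneg]
        linarith

theorem exists_mul_sq_add_le_mul_sqrt {R V L : ℝ} (hR : 0 < R) (hL : 0 ≤ L) :
    ∃ θ : ℝ, 0 ≤ θ ∧ θ * R ≤ 1 ∧ θ ^ 2 * V + L ≤ θ * (2 * √(V * L) + 2 * R * L) := by
  rcases le_or_gt V (R ^ 2 * L) with h | h
  · refine ⟨R⁻¹, by positivity, (inv_mul_cancel₀ hR.ne').le, ?_⟩
    have hVR : R⁻¹ ^ 2 * V ≤ L := by
      rw [inv_pow, inv_mul_le_iff₀ (by positivity)]
      exact h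
    have hRL : R⁻¹ * (2 * R * L) = 2 * L := by field_simp
    have hsqrt : 0 ≤ R⁻¹ * (2 * √(V * L)) := by positivity
    linarith
  · have hV0 : 0 < V := (by positivity : 0 ≤ R ^ 2 * L).trans_lt h
    have hsq : √(L / V) ^ 2 * V = L := by
      rw [Real.sq_sqrt (by positivity), div_mul_cancel₀ _ hV0.ne']
    have hmul : √(L / V) * √(V * L) = L := by
      rw [← Real.sqrt_mul (by positivity), ← mul_assoc, div_mul_cancel₀ _ hV0.ne',
        Real.sqrt_mul_self hL]
    refine ⟨√(L / V), Real.sqrt_nonneg _, ?_, ?_⟩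
    · rw [← Real.sqrt_sq hR.le, ← Real.sqrt_mul (by positivity), Real.sqrt_le_one,
        div_mul_eq_mul_div, div_le_one hV0]
      linarith
    · have hRL : 0 ≤ √(L / V) * (2 * R * L) := by positivity
      linarith

theorem matrix_bernstein [Nonempty m] (hY : ∀ k, Measurable (Y k))
    (hind : iIndepFun Y μ) (hherm : ∀ k ω, (Y k ω).IsHermitian) {R : ℝ} (hR : 0 < R)
    (hbd : ∀ k ω, ‖Y k ω‖ ≤ R) (hmean : ∀ k, ∫ ω, Y k ω ∂μ = 0)
    (hvar : ∀ k, ∫ ω, Y k ω * Y k ω ∂μ ≤ w k • 1) {L : ℝ} (hL : 0 ≤ L) :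
    μ.real {ω | 2 * √((∑ k, w k) * L) + 2 * R * L ≤ ‖∑ k, Y k ω‖} ≤
      2 * Fintype.card m * Real.exp (-L) := by
  obtain ⟨θ, hθ, hθR, hθL⟩ := exists_mul_sq_add_le_mul_sqrt hR hL
  set s := 2 * √((∑ k, w k) * L) + 2 * R * L
  have hsmul : Measurable fun A : Matrix m m 𝕜 => θ • A := measurable_const_smul θ
  have hbd' : ∀ k ω, ‖θ • Y k ω‖ ≤ 1 := fun k ω => by
    rw [norm_smul, Real.norm_of_nonneg hθ]
    exact (mul_le_mul_of_nonneg_left (hbd k ω) hθ).trans hθR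
  have hmean' : ∀ k, ∫ ω, θ • Y k ω ∂μ = 0 := fun k => by rw [integral_smul, hmean, smul_zero]
  have hvar' : ∀ k, ∫ ω, (θ • Y k ω) * (θ • Y k ω) ∂μ ≤ (θ ^ 2 * w k) • 1 := fun k => by
    simp only [smul_mul_smul_comm, ← pow_two θ, integral_smul, mul_smul]
    exact smul_le_smul_of_nonneg_left (hvar k) (sq_nonneg θ)
  obtain ⟨hint, hlaplace⟩ := integral_exp_norm_sum_le (fun k => hsmul.comp (hY k))
    (hind.comp (fun _ A => θ • A) fun _ => hsmul)
    (fun k ω => (hherm k ω).smul (IsSelfAdjoint.all θ)) hbd' hmean' hvar'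
  simp only [Function.comp_apply, ← Finset.smul_sum, ← Finset.mul_sum, norm_smul,
    Real.norm_of_nonneg hθ] at hint hlaplace
  have hmarkov := mul_meas_ge_le_integral_of_nonneg
    (.of_forall fun ω => (Real.exp_pos (θ * ‖∑ k, Y k ω‖)).le) hint (Real.exp (θ * s))
  have hsub : {ω | s ≤ ‖∑ k, Y k ω‖} ⊆ {ω | Real.exp (θ * s) ≤ Real.exp (θ * ‖∑ k, Y k ω‖)} :=
    fun ω hω => Real.exp_le_exp.2 (mul_le_mul_of_nonneg_left hω hθ)
  refine le_of_mul_le_mul_left ?_ (Real.exp_pos (θ * s))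
  calc Real.exp (θ * s) * μ.real {ω | s ≤ ‖∑ k, Y k ω‖}
      ≤ Real.exp (θ * s) * μ.real {ω | Real.exp (θ * s) ≤ Real.exp (θ * ‖∑ k, Y k ω‖)} := by
        gcongr
        exact measure_ne_top μ _
    _ ≤ 2 * Fintype.card m * Real.exp (θ ^ 2 * ∑ k, w k) := hmarkov.trans hlaplace
    _ ≤ 2 * Fintype.card m * Real.exp (θ * s - L) := by gcongr; linarith
    _ = Real.exp (θ * s) * (2 * Fintype.card m * Real.exp (-L)) := by
      rw [sub_eq_add_neg, Real.exp_add]; ring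

end MatrixBernstein

section LoewnerOrder

open Matrix
open scoped Matrix.Norms.L2Operator MatrixOrder ComplexOrder

variable {𝕜 : Type*} [RCLike 𝕜] {m : Type*} [Fintype m] [DecidableEq m] {A B : Matrix m m 𝕜}

attribute [local instance] matrixNormedAlgebraReal

theorem le_norm_smul_one (hA : A.IsHermitian) : A ≤ ‖A‖ • 1 := by
  rw [← Algebra.algebraMap_eq_smul_one, le_algebraMap_iff_spectrum_le hA.isSelfAdjoint]
  exact fun x hx => (le_abs_self x).trans
    (IsometricContinuousFunctionalCalculus.norm_spectrum_le (𝕜 := ℝ) A hx hA.isSelfAdjoint)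

theorem norm_le_of_neg_le_of_le [Nonempty m] (hA : A.IsHermitian) {c : ℝ} (hneg : -A ≤ c • 1)
    (hpos : A ≤ c • 1) : ‖A‖ ≤ c := by
  rw [← Algebra.algebraMap_eq_smul_one] at hneg hpos
  obtain ⟨x, hx, hxA⟩ := (IsometricContinuousFunctionalCalculus.isGreatest_norm_spectrum (𝕜 := ℝ)
    A hA.isSelfAdjoint).1
  have hnegx : -x ∈ spectrum ℝ (-A) := by simpa [← spectrum.neg_eq] using hx
  rw [← hxA]
  exact abs_le'.2 ⟨(le_algebraMap_iff_spectrum_le hA.isSelfAdjoint).1 hpos x hx,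
    (le_algebraMap_iff_spectrum_le hA.neg.isSelfAdjoint).1 hneg _ hnegx⟩

theorem le_re_trace_smul_one (hA : 0 ≤ A) : A ≤ RCLike.re A.trace • 1 := by
  have hpsd := nonneg_iff_posSemidef.1 hA
  rw [← Algebra.algebraMap_eq_smul_one, le_algebraMap_iff_spectrum_le hpsd.1.isSelfAdjoint,
    hpsd.1.spectrum_real_eq_range_eigenvalues, Set.forall_mem_range,
    hpsd.1.trace_eq_sum_eigenvalues, map_sum]
  simp only [RCLike.ofReal_re]
  exact fun i => Finset.single_le_sum (fun j _ => hpsd.eigenvalues_nonneg j) (Finset.mem_univ i)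

omit [DecidableEq m] in
theorem mul_self_add_conjTranspose_le (A : Matrix m m 𝕜) :
    (A + Aᴴ) * (A + Aᴴ) ≤ (2 : ℝ) • (A * Aᴴ + Aᴴ * A) := by
  have hnonneg : 0 ≤ (A - Aᴴ) * (A - Aᴴ)ᴴ := (posSemidef_self_mul_conjTranspose _).nonneg
  rw [← sub_nonneg]
  convert hnonneg using 1
  rw [conjTranspose_sub, conjTranspose_conjTranspose, two_smul]
  noncomm_ring

end LoewnerOrder

section RankOne

open Matrix
open scoped Matrix.Norms.L2Operator MatrixOrder ComplexOrder

variable {𝕜 : Type*} [RCLike 𝕜] {p : ℕ}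

attribute [local instance] matrixNormedAlgebraReal

theorem outer_apply (u v : Fin p → 𝕜) (i j : Fin p) : outer u v i j = u i * star (v j) := rfl

theorem conjTranspose_outer (u v : Fin p → 𝕜) : (outer u v)ᴴ = outer v u := by
  rw [outer, conjTranspose_vecMulVec, star_star, outer]

theorem outer_mul_outer (u v w x : Fin p → 𝕜) :
    outer u v * outer w x = (star v ⬝ᵥ w) • outer u x := by
  rw [outer, outer, vecMulVec_mul_vecMulVec, vecMulVec_smul, outer]

theorem outer_self_nonneg (u : Fin p → 𝕜) : 0 ≤ outer u u :=
  (posSemidef_vecMulVec_self_star u).nonneg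

theorem re_trace_outer_self (u : Fin p → 𝕜) : RCLike.re (outer u u).trace = ∑ i, ‖u i‖ ^ 2 := by
  rw [trace, map_sum]
  refine Finset.sum_congr rfl fun i _ => ?_
  rw [diag_apply, outer_apply, RCLike.star_def, RCLike.mul_conj]
  norm_cast

theorem star_dotProduct_self (u : Fin p → 𝕜) : star u ⬝ᵥ u = ((∑ i, ‖u i‖ ^ 2 : ℝ) : 𝕜) := by
  simp only [dotProduct, Pi.star_apply, RCLike.star_def, RCLike.conj_mul]
  push_cast
  rfl

theorem outer_add_smul_self (c : ℝ) (u v : Fin p → 𝕜) :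
    outer (u + (c : 𝕜) • v) (u + (c : 𝕜) • v) =
      outer u u + c • (outer u v + outer v u) + c ^ 2 • outer v v := by
  ext i j
  simp only [outer_apply, Matrix.add_apply, Matrix.smul_apply, Pi.add_apply, Pi.smul_apply,
    smul_eq_mul, RCLike.real_smul_eq_coe_mul, star_add, star_mul', RCLike.star_def,
    RCLike.conj_ofReal, RCLike.ofReal_pow]
  ring

theorem outer_add_outer_le {s : ℝ} (hs : 0 < s) (u v : Fin p → 𝕜) :
    outer u v + outer v u ≤ s • outer u u + s⁻¹ • outer v v := by
  have hsq := smul_nonneg hs.le (outer_self_nonneg (u + ((-s⁻¹ : ℝ) : 𝕜) • v))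
  rw [outer_add_smul_self, smul_add, smul_add, smul_smul, smul_smul, mul_neg,
    mul_inv_cancel₀ hs.ne', neg_sq, sq, ← mul_assoc, mul_inv_cancel₀ hs.ne', one_mul,
    neg_one_smul] at hsq
  rw [← sub_nonneg]
  convert hsq using 1
  abel

theorem neg_outer_add_outer_le {s : ℝ} (hs : 0 < s) (u v : Fin p → 𝕜) :
    -(outer u v + outer v u) ≤ s • outer u u + s⁻¹ • outer v v := by
  have hneg : ∀ w : Fin p → 𝕜, outer (-w) (-w) = outer w w := fun w => by
    simp [outer, neg_vecMulVec, vecMulVec_neg]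
  have h := outer_add_outer_le hs (-u) v
  rw [hneg, outer, outer, neg_vecMulVec, star_neg, vecMulVec_neg, ← neg_add] at h
  exact h

theorem outer_sub_self (u v : Fin p → 𝕜) :
    outer (u - v) (u - v) = outer u u - (outer u v + outer v u) + outer v v := by
  have h := outer_add_smul_self (-1) u v
  rw [RCLike.ofReal_neg, RCLike.ofReal_one, neg_one_smul, neg_one_smul, neg_sq, one_pow,
    one_smul, ← sub_eq_add_neg, ← sub_eq_add_neg] at h
  exact h

theorem outer_sub_self_le {s : ℝ} (hs : 0 < s) (u v : Fin p → 𝕜) :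
    outer (u - v) (u - v) ≤ (1 + s) • outer u u + (1 + s⁻¹) • outer v v := by
  rw [outer_sub_self, add_smul, add_smul, one_smul, one_smul]
  convert add_le_add_left (neg_outer_add_outer_le hs u v) (outer u u + outer v v) using 1 <;> abel

theorem outer_self_sub_outer_sub_self_le {s : ℝ} (hs : 0 < s) (u v : Fin p → 𝕜) :
    outer u u - outer (u - v) (u - v) ≤ s • outer u u + s⁻¹ • outer v v := by
  rw [outer_sub_self]
  refine le_trans ?_ (outer_add_outer_le hs u v)
  convert sub_le_self _ (outer_self_nonneg v) using 1
  abel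

end RankOne

section Dither

variable {𝕜 : Type*} [RCLike 𝕜] {lam : ℝ}

/-- The truncation of a real number to `[-lam, lam]`: up to the factor `lam`, the mean of the
dithered sign. -/
def clipReal (lam a : ℝ) : ℝ := max (-lam) (min a lam)

/-- The truncation of the real and the imaginary part to `[-lam, lam]`, which over `𝕜` plays the
role of `clipReal`. -/
noncomputable def clip (lam : ℝ) (z : 𝕜) : 𝕜 :=
  (clipReal lam (RCLike.re z) : 𝕜) + (clipReal lam (RCLike.im z) : 𝕜) * RCLike.I

theorem measurable_clipReal : Measurable (clipReal lam) :=
  measurable_const.max (measurable_id.min measurable_const)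

theorem abs_clipReal_le (h : 0 ≤ lam) (a : ℝ) : |clipReal lam a| ≤ lam :=
  abs_le.2 ⟨le_max_left _ _, max_le (by linarith) (min_le_right _ _)⟩

theorem clipReal_eq_self {a : ℝ} (h : |a| ≤ lam) : clipReal lam a = a := by
  rw [clipReal, min_eq_left (abs_le.1 h).2, max_eq_right (abs_le.1 h).1]

theorem norm_sq_ofReal_add_mul_I_le (a b : ℝ) :
    ‖(a : 𝕜) + (b : 𝕜) * RCLike.I‖ ^ 2 ≤ a ^ 2 + b ^ 2 := by
  rw [RCLike.norm_sq_eq_def]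
  rcases RCLike.I_eq_zero_or_im_I_eq_one (K := 𝕜) with h | h
  · simpa [h, ← sq] using sq_nonneg b
  · simp [h, ← sq]

theorem measurable_ofReal_add_mul_I :
    Measurable fun z : ℝ × ℝ => (z.1 : 𝕜) + (z.2 : 𝕜) * RCLike.I :=
  (RCLike.measurable_ofReal.comp measurable_fst).add
    ((RCLike.measurable_ofReal.comp measurable_snd).mul_const _)

theorem measurable_clip : Measurable (clip lam : 𝕜 → 𝕜) :=
  measurable_ofReal_add_mul_I.comp
    ((measurable_clipReal.comp RCLike.measurable_re).prodMk
      (measurable_clipReal.comp RCLike.measurable_im))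

theorem norm_clip_le (h : 0 ≤ lam) (z : 𝕜) : ‖clip lam z‖ ≤ 2 * lam := by
  have hsq : ∀ a, clipReal lam a ^ 2 ≤ lam ^ 2 := fun a =>
    sq_le_sq.2 ((abs_clipReal_le h a).trans (le_abs_self lam))
  have := (norm_sq_ofReal_add_mul_I_le (𝕜 := 𝕜) _ _).trans
    (add_le_add (hsq (RCLike.re z)) (hsq (RCLike.im z)))
  exact abs_le_of_sq_le_sq' (by rw [clip]; nlinarith) (by positivity) |>.2

theorem norm_sub_clip_sq_le (z : 𝕜) : ‖z - clip lam z‖ ^ 2 ≤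
    (RCLike.re z - clipReal lam (RCLike.re z)) ^ 2 +
      (RCLike.im z - clipReal lam (RCLike.im z)) ^ 2 := by
  have h : z - clip lam z = ((RCLike.re z - clipReal lam (RCLike.re z) : ℝ) : 𝕜) +
      ((RCLike.im z - clipReal lam (RCLike.im z) : ℝ) : 𝕜) * RCLike.I := by
    rw [clip]
    push_cast
    linear_combination -(RCLike.re_add_im z)
  exact h ▸ norm_sq_ofReal_add_mul_I_le _ _

theorem clip_eq_self {z : 𝕜} (h : ‖z‖ ≤ lam) : clip lam z = z := by
  rw [clip, clipReal_eq_self ((RCLike.abs_re_le_norm z).trans h),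
    clipReal_eq_self ((RCLike.abs_im_le_norm z).trans h), RCLike.re_add_im]

theorem measurable_signReal : Measurable signReal :=
  Measurable.ite measurableSet_Ici measurable_const measurable_const

theorem abs_signReal (a : ℝ) : |signReal a| = 1 := by
  unfold signReal; split_ifs <;> simp

theorem signReal_eq_indicator (a : ℝ) :
    signReal a = 2 * (Set.Ici (0 : ℝ)).indicator 1 a - 1 := by
  by_cases h : 0 ≤ a
  · rw [signReal, if_pos h, Set.indicator_of_mem (Set.mem_Ici.2 h), Pi.one_apply]; norm_num
  · rw [signReal, if_neg h, Set.indicator_of_notMem (by simpa using h)]; norm_num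

theorem measurable_signF : Measurable (signF : 𝕜 → 𝕜) :=
  measurable_ofReal_add_mul_I.comp
    ((measurable_signReal.comp RCLike.measurable_re).prodMk
      (measurable_signReal.comp RCLike.measurable_im))

theorem norm_signF_sq_le (z : 𝕜) : ‖signF z‖ ^ 2 ≤ 2 := by
  refine (norm_sq_ofReal_add_mul_I_le _ _).trans ?_
  rw [← sq_abs, abs_signReal, ← sq_abs (signReal _), abs_signReal]
  norm_num

theorem norm_signF_le (z : 𝕜) : ‖signF z‖ ≤ 2 := by
  nlinarith [norm_signF_sq_le z]

theorem signF_add (z : 𝕜) (u v : ℝ) : signF (z + ((u : 𝕜) + (v : 𝕜) * RCLike.I)) =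
    (signReal (RCLike.re z + u) : 𝕜) + (signReal (RCLike.im z + v) : 𝕜) * RCLike.I := by
  rcases RCLike.I_eq_zero_or_im_I_eq_one (K := 𝕜) with h | h <;> simp [signF, h]

theorem isProbabilityMeasure_uniformLaw (h : 0 < lam) :
    IsProbabilityMeasure (uniformLaw lam) := by
  refine cond_isProbabilityMeasure_of_finite ?_ ?_ <;> simp [h]

theorem isProbabilityMeasure_ditherLaw (h : 0 < lam) :
    IsProbabilityMeasure (ditherLaw 𝕜 lam) := by
  have := isProbabilityMeasure_uniformLaw h
  exact Measure.isProbabilityMeasure_map measurable_ofReal_add_mul_I.aemeasurable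

theorem isProbabilityMeasure_ditherVecLaw (h : 0 < lam) (p : ℕ) :
    IsProbabilityMeasure (ditherVecLaw 𝕜 p lam) := by
  have := isProbabilityMeasure_ditherLaw (𝕜 := 𝕜) h
  unfold ditherVecLaw
  infer_instance

theorem measureReal_uniformLaw_Ici_neg (h : 0 < lam) (a : ℝ) :
    (uniformLaw lam).real (Set.Ici (-a)) = (lam + clipReal lam a) / (2 * lam) := by
  have hlen : max (lam - max (-lam) (-a)) 0 = lam + clipReal lam a := by
    rw [clipReal, max_neg_neg, sub_neg_eq_add, ← max_add_add_left, add_neg_cancel, max_comm,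
      min_comm]
  rw [uniformLaw, measureReal_def, cond_apply measurableSet_Icc, Set.inter_comm,
    ← Set.Ici_inter_Iic, ← Set.inter_assoc, Set.Ici_inter_Ici, Set.Ici_inter_Iic,
    Set.Ici_inter_Iic, Real.volume_Icc, Real.volume_Icc, ENNReal.toReal_mul, ENNReal.toReal_inv,
    ENNReal.toReal_ofReal (by linarith), ENNReal.toReal_ofReal', ← hlen, max_comm (-a)]
  ring

theorem integral_signReal_add (h : 0 < lam) (a : ℝ) :
    ∫ u, signReal (a + u) ∂uniformLaw lam = clipReal lam a / lam := by
  have := isProbabilityMeasure_uniformLaw h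
  have hsign : ∀ u, signReal (a + u) = 2 * (Set.Ici (-a)).indicator 1 u - 1 := fun u => by
    rw [signReal_eq_indicator, Set.indicator_apply, Set.indicator_apply]
    simp only [Set.mem_Ici, neg_le_iff_add_nonneg', Pi.one_apply]
  have hint : Integrable ((Set.Ici (-a)).indicator (1 : ℝ → ℝ)) (uniformLaw lam) :=
    (integrable_const (1 : ℝ)).indicator measurableSet_Ici
  simp only [hsign]
  rw [integral_sub (hint.const_mul _) (integrable_const _), integral_const_mul,
    integral_indicator_one measurableSet_Ici, integral_const, probReal_univ,
    measureReal_uniformLaw_Ici_neg h, one_smul]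
  field_simp
  ring

theorem integral_signF_add (h : 0 < lam) (z : 𝕜) :
    ∫ w, signF (z + w) ∂ditherLaw 𝕜 lam = clip lam z / (lam : 𝕜) := by
  have := isProbabilityMeasure_uniformLaw h
  have hint : ∀ a : ℝ, Integrable (fun u => (signReal (a + u) : 𝕜)) (uniformLaw lam) := fun a =>
    Integrable.of_bound (RCLike.measurable_ofReal.comp
      (measurable_signReal.comp (measurable_const_add a))).aestronglyMeasurable 1
      (.of_forall fun u => by rw [RCLike.norm_ofReal, abs_signReal])
  have hmean : ∀ a : ℝ, ∫ u, (signReal (a + u) : 𝕜) ∂uniformLaw lam = (clipReal lam a / lam : ℝ) :=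
    fun a => by rw [integral_ofReal, integral_signReal_add h]
  have hmeas : Measurable fun w : 𝕜 => signF (z + w) :=
    measurable_signF.comp (measurable_const_add z)
  rw [ditherLaw, integral_map measurable_ofReal_add_mul_I.aemeasurable hmeas.aestronglyMeasurable]
  simp only [signF_add]
  rw [integral_add ((hint _).comp_fst _) (((hint _).comp_snd _).mul_const _), integral_mul_const,
    integral_fun_fst (fun u => (signReal (RCLike.re z + u) : 𝕜)),
    integral_fun_snd (fun u => (signReal (RCLike.im z + u) : 𝕜)), hmean, hmean, probReal_univ,
    one_smul, one_smul, clip]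
  push_cast
  ring

end Dither

section SecondMoment

open Matrix
open scoped Matrix.Norms.L2Operator MatrixOrder ComplexOrder

attribute [local instance] matrixNormedAlgebraReal matrix_orderClosedTopology

variable {𝕜 : Type*} [RCLike 𝕜] {Ω : Type*} [MeasurableSpace Ω] {μ : Measure Ω}

theorem integrable_matrix_of_forall_apply {m : Type*} [Fintype m] [DecidableEq m]
    {X : Ω → Matrix m m 𝕜} (hX : ∀ i j, Integrable (fun ω => X ω i j) μ) : Integrable X μ := by
  have hsum : X = fun ω => ∑ i, ∑ j,
      (singleLinearMap ℝ i j : 𝕜 →ₗ[ℝ] Matrix m m 𝕜).toContinuousLinearMap (X ω i j) :=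
    funext fun ω => matrix_eq_sum_single (X ω)
  rw [hsum]
  exact integrable_finsetSum _ fun i _ => integrable_finsetSum _ fun j _ =>
    ContinuousLinearMap.integrable_comp _ (hX i j)

theorem integral_matrix_apply {m : Type*} [Fintype m] [DecidableEq m] {X : Ω → Matrix m m 𝕜}
    (hX : Integrable X μ) (i j : m) : (∫ ω, X ω ∂μ) i j = ∫ ω, X ω i j ∂μ :=
  ((entryLinearMap ℝ 𝕜 i j).toContinuousLinearMap.integral_comp_comm hX).symm

theorem integral_conjTranspose {m : Type*} [Fintype m] [DecidableEq m] (X : Ω → Matrix m m 𝕜) :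
    ∫ ω, (X ω)ᴴ ∂μ = (∫ ω, X ω ∂μ)ᴴ :=
  (starL' ℝ : Matrix m m 𝕜 ≃L[ℝ] Matrix m m 𝕜).integral_comp_comm X

variable {p : ℕ} {y z u v : Ω → Fin p → 𝕜} {ζ : ℝ}

theorem integrable_outer (hu : ∀ i, MemLp (fun ω => u ω i) 2 μ)
    (hv : ∀ i, MemLp (fun ω => v ω i) 2 μ) : Integrable (fun ω => outer (u ω) (v ω)) μ :=
  integrable_matrix_of_forall_apply fun i j => (hu i).integrable_mul (hv j).star

theorem secondMoment_eq_integral (hy : ∀ i, MemLp (fun ω => y ω i) 2 μ) :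
    secondMoment μ y = ∫ ω, outer (y ω) (y ω) ∂μ := by
  ext i j
  rw [integral_matrix_apply (integrable_outer hy hy), secondMoment, of_apply]

theorem secondMoment_nonneg (hy : ∀ i, MemLp (fun ω => y ω i) 2 μ) : 0 ≤ secondMoment μ y := by
  rw [secondMoment_eq_integral hy]
  exact integral_nonneg fun ω => outer_self_nonneg (y ω)

theorem secondMoment_le_opNorm_smul_one (hy : ∀ i, MemLp (fun ω => y ω i) 2 μ) :
    secondMoment μ y ≤ opNorm (secondMoment μ y) • 1 :=
  le_norm_smul_one (nonneg_iff_posSemidef.1 (secondMoment_nonneg hy)).isHermitian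

theorem secondMoment_le_smul_one (hy : ∀ i, MemLp (fun ω => y ω i) 2 μ)
    (hζ : ∫ ω, ∑ i, ‖y ω i‖ ^ 2 ∂μ ≤ ζ) : secondMoment μ y ≤ ζ • 1 := by
  have hint : Integrable (fun ω => ∑ i, ‖y ω i‖ ^ 2) μ :=
    integrable_finsetSum _ fun i _ => (hy i).integrable_norm_pow two_ne_zero
  rw [secondMoment_eq_integral hy]
  calc ∫ ω, outer (y ω) (y ω) ∂μ
      ≤ ∫ ω, (∑ i, ‖y ω i‖ ^ 2) • (1 : Matrix (Fin p) (Fin p) 𝕜) ∂μ :=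
        integral_mono (integrable_outer hy hy) (hint.smul_const _) fun ω => by
          rw [← re_trace_outer_self]
          exact le_re_trace_smul_one (outer_self_nonneg (y ω))
    _ ≤ ζ • 1 := by
        rw [integral_smul_const]
        exact smul_le_smul_of_nonneg_right hζ zero_le_one

theorem secondMoment_sub_le (hu : ∀ i, MemLp (fun ω => u ω i) 2 μ)
    (hv : ∀ i, MemLp (fun ω => v ω i) 2 μ) {s : ℝ} (hs : 0 < s) :
    secondMoment μ (fun ω => u ω - v ω) ≤
      (1 + s) • secondMoment μ u + (1 + s⁻¹) • secondMoment μ v := by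
  have huv : ∀ i, MemLp (fun ω => (u ω - v ω) i) 2 μ := fun i => (hu i).sub (hv i)
  have huu : Integrable (fun ω => (1 + s) • outer (u ω) (u ω)) μ :=
    (integrable_outer hu hu).fun_smul _
  have hvv : Integrable (fun ω => (1 + s⁻¹) • outer (v ω) (v ω)) μ :=
    (integrable_outer hv hv).fun_smul _
  rw [secondMoment_eq_integral hu, secondMoment_eq_integral hv, secondMoment_eq_integral huv,
    ← integral_smul, ← integral_smul, ← integral_add huu hvv]
  exact integral_mono (integrable_outer huv huv) (huu.add hvv) fun ω => outer_sub_self_le hs _ _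

theorem secondMoment_sub_secondMoment_sub_le (hu : ∀ i, MemLp (fun ω => u ω i) 2 μ)
    (hv : ∀ i, MemLp (fun ω => v ω i) 2 μ) {s : ℝ} (hs : 0 < s) :
    secondMoment μ u - secondMoment μ (fun ω => u ω - v ω) ≤
      s • secondMoment μ u + s⁻¹ • secondMoment μ v := by
  have huv : ∀ i, MemLp (fun ω => (u ω - v ω) i) 2 μ := fun i => (hu i).sub (hv i)
  have huu : Integrable (fun ω => s • outer (u ω) (u ω)) μ := (integrable_outer hu hu).fun_smul _
  have hvv : Integrable (fun ω => s⁻¹ • outer (v ω) (v ω)) μ := (integrable_outer hv hv).fun_smul _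
  rw [secondMoment_eq_integral hu, secondMoment_eq_integral hv, secondMoment_eq_integral huv,
    ← integral_smul, ← integral_smul, ← integral_add huu hvv,
    ← integral_sub (integrable_outer hu hu) (integrable_outer huv huv)]
  exact integral_mono ((integrable_outer hu hu).sub (integrable_outer huv huv)) (huu.add hvv)
    fun ω => outer_self_sub_outer_sub_self_le hs _ _

theorem le_two_mul_sqrt_mul_sqrt {a b x : ℝ} (ha : 0 ≤ a) (hb : 0 ≤ b)
    (h : ∀ s > 0, x ≤ s * a + s⁻¹ * b) : x ≤ 2 * (√a * √b) := by
  rcases le_or_gt x 0 with hx | hx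
  · exact hx.trans (by positivity)
  have hdiscrim : discrim a (-x) b ≤ 0 := by
    refine discrim_le_zero fun s => ?_
    rcases le_or_gt s 0 with hs | hs
    · nlinarith [mul_nonneg_of_nonpos_of_nonpos hs hs]
    · have := h s hs
      field_simp at this
      linarith
  rw [discrim] at hdiscrim
  rw [← Real.sqrt_mul ha]
  refine le_of_sq_le_sq ?_ (by positivity)
  rw [mul_pow, Real.sq_sqrt (by positivity)]
  linarith

theorem opNorm_secondMoment_sub_le [NeZero p] (hy : ∀ i, MemLp (fun ω => y ω i) 2 μ)
    (hz : ∀ i, MemLp (fun ω => z ω i) 2 μ) (hζ : ∫ ω, ∑ i, ‖z ω i‖ ^ 2 ∂μ ≤ ζ) :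
    opNorm (secondMoment μ (fun ω => y ω - z ω) - secondMoment μ y) ≤
      2 * (√(opNorm (secondMoment μ y)) * √ζ) + ζ := by
  have hζ0 : 0 ≤ ζ := (integral_nonneg fun ω => by positivity).trans hζ
  have hherm : ∀ {w : Ω → Fin p → 𝕜}, (∀ i, MemLp (fun ω => w ω i) 2 μ) →
      (secondMoment μ w).IsHermitian := fun hw =>
    (nonneg_iff_posSemidef.1 (secondMoment_nonneg hw)).isHermitian
  rw [← sub_le_iff_le_add]
  refine le_two_mul_sqrt_mul_sqrt (norm_nonneg _) hζ0 fun s hs => ?_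
  have hs' := inv_pos.2 hs
  have hV := smul_le_smul_of_nonneg_left (secondMoment_le_opNorm_smul_one hy) hs.le
  have hZ := smul_le_smul_of_nonneg_left (secondMoment_le_smul_one hz hζ)
    (add_pos one_pos hs').le
  have hbound : s • secondMoment μ y + (1 + s⁻¹) • secondMoment μ z ≤
      (s * opNorm (secondMoment μ y) + s⁻¹ * ζ + ζ) • 1 := by
    refine (add_le_add hV hZ).trans (le_of_eq ?_)
    module
  rw [sub_le_iff_le_add]
  refine norm_le_of_neg_le_of_le ((hherm fun i => (hy i).sub (hz i)).sub (hherm hy))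
    (le_trans ?_ hbound) (le_trans ?_ hbound)
  · rw [neg_sub]
    refine (secondMoment_sub_secondMoment_sub_le hy hz hs).trans ?_
    rw [add_smul, one_smul]
    gcongr
    exact le_add_of_nonneg_left (secondMoment_nonneg hz)
  · rw [sub_le_iff_le_add]
    refine (secondMoment_sub_le hy hz hs).trans (le_of_eq ?_)
    rw [add_smul, one_smul]
    abel

end SecondMoment

section IndependentEntries

open Matrix
open scoped Matrix.Norms.L2Operator MatrixOrder ComplexOrder

attribute [local instance] matrixNormedAlgebraReal matrix_orderClosedTopology

variable {𝕜 : Type*} [RCLike 𝕜] {p : ℕ}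

theorem integral_outer_le_of_pairwise_indepFun {Ω : Type*} [MeasurableSpace Ω] {μ : Measure Ω}
    {X : Ω → Fin p → 𝕜} {v : ℝ} (hX : ∀ i, MemLp (fun ω => X ω i) 2 μ)
    (hv : ∀ i, ∫ ω, ‖X ω i‖ ^ 2 ∂μ ≤ v)
    (hind : Pairwise fun i j => IndepFun (fun ω => X ω i) (fun ω => X ω j) μ) :
    ∫ ω, outer (X ω) (X ω) ∂μ ≤
      outer (fun i => ∫ ω, X ω i ∂μ) (fun i => ∫ ω, X ω i ∂μ) + v • 1 := by
  set m : Fin p → 𝕜 := fun i => ∫ ω, X ω i ∂μ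
  have hdiag : outer m m + v • 1 - ∫ ω, outer (X ω) (X ω) ∂μ =
      diagonal fun i => ((‖m i‖ ^ 2 + (v - ∫ ω, ‖X ω i‖ ^ 2 ∂μ) : ℝ) : 𝕜) := by
    ext i j
    rw [Matrix.sub_apply, Matrix.add_apply, integral_matrix_apply (integrable_outer hX hX)]
    rcases eq_or_ne i j with rfl | hij
    · simp only [outer_apply, RCLike.star_def, RCLike.mul_conj, Matrix.smul_apply, one_apply_eq,
        diagonal_apply_eq, ← RCLike.ofReal_pow]
      rw [integral_ofReal, RCLike.real_smul_eq_coe_mul, mul_one]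
      push_cast
      ring
    · simp only [outer_apply, RCLike.star_def, Matrix.smul_apply, one_apply_ne hij, smul_zero,
        add_zero, diagonal_apply_ne _ hij]
      have hprod := ((hind hij).comp measurable_id
        continuous_star.measurable).integral_fun_mul_eq_mul_integral (hX i).aestronglyMeasurable
        (hX j).star.aestronglyMeasurable
      simp only [Function.comp_apply, id_eq, RCLike.star_def, integral_conj] at hprod
      rw [hprod, sub_self]
  rw [← sub_nonneg, hdiag, nonneg_iff_posSemidef, posSemidef_diagonal_iff]
  exact fun i => RCLike.ofReal_nonneg.2 (add_nonneg (by positivity) (sub_nonneg.2 (hv i)))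

variable {lam : ℝ}

theorem measurable_quantize :
    Measurable fun z : (Fin p → 𝕜) × (Fin p → 𝕜) => quantize z.1 z.2 :=
  measurable_pi_lambda _ fun i => measurable_signF.comp
    (((measurable_pi_apply i).comp measurable_fst).add
      ((measurable_pi_apply i).comp measurable_snd))

theorem memLp_quantize {Ω : Type*} [MeasurableSpace Ω] {μ : Measure Ω} [IsFiniteMeasure μ]
    {y τ : Ω → Fin p → 𝕜} (hy : Measurable y) (hτ : Measurable τ) (i : Fin p) :
    MemLp (fun ω => quantize (y ω) (τ ω) i) 2 μ :=
  .of_bound ((measurable_pi_apply i).comp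
      (measurable_quantize.comp (hy.prodMk hτ))).aestronglyMeasurable 2
    (.of_forall fun _ => norm_signF_le _)

theorem integral_quantize (h : 0 < lam) (y : Fin p → 𝕜) (i : Fin p) :
    ∫ τ, quantize y τ i ∂ditherVecLaw 𝕜 p lam = clip lam (y i) / (lam : 𝕜) := by
  have := isProbabilityMeasure_ditherLaw (𝕜 := 𝕜) h
  rw [← integral_signF_add h, ditherVecLaw]
  exact integral_comp_eval (μ := fun _ : Fin p => ditherLaw 𝕜 lam) (f := fun w => signF (y i + w))
    (measurable_signF.comp (measurable_const_add (y i))).aestronglyMeasurable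

theorem integral_outer_quantize_self_le (h : 0 < lam) (y : Fin p → 𝕜) :
    lam ^ 2 • ∫ τ, outer (quantize y τ) (quantize y τ) ∂ditherVecLaw 𝕜 p lam ≤
      outer (clip lam ∘ y) (clip lam ∘ y) + (2 * lam ^ 2) • 1 := by
  have := isProbabilityMeasure_ditherLaw (𝕜 := 𝕜) h
  have := isProbabilityMeasure_ditherVecLaw (𝕜 := 𝕜) h p
  have hind : iIndepFun (fun i (τ : Fin p → 𝕜) => quantize y τ i) (ditherVecLaw 𝕜 p lam) :=
    iIndepFun_pi (X := fun i w => signF (y i + w)) fun i =>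
      (measurable_signF.comp (measurable_const_add (y i))).aemeasurable
  have hmain := integral_outer_le_of_pairwise_indepFun (v := 2)
    (fun i => memLp_quantize (μ := ditherVecLaw 𝕜 p lam) measurable_const measurable_id i)
    (fun i => ?_) fun i j hij => hind.indepFun hij
  · refine (smul_le_smul_of_nonneg_left hmain (sq_nonneg lam)).trans (le_of_eq ?_)
    have hlam : (lam : 𝕜) ≠ 0 := RCLike.ofReal_ne_zero.2 h.ne'
    simp only [id_eq, integral_quantize h, smul_add, smul_smul, mul_comm (lam ^ 2) 2]
    congr 1
    ext i j
    simp only [outer_apply, Matrix.smul_apply, Function.comp_apply, RCLike.real_smul_eq_coe_mul,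
      RCLike.star_def, map_div₀, RCLike.conj_ofReal, RCLike.ofReal_pow]
    field_simp
  · refine (integral_mono_of_nonneg (.of_forall fun τ => sq_nonneg _) (integrable_const 2)
      (.of_forall fun τ => norm_signF_sq_le _)).trans (by simp)

end IndependentEntries

section SampleMatrix

open Matrix
open scoped Matrix.Norms.L2Operator MatrixOrder ComplexOrder

attribute [local instance] matrixNormedAlgebraReal matrixMeasurableSpace matrix_borelSpace
  matrix_secondCountableTopology matrix_orderClosedTopology

variable {𝕜 : Type*} [RCLike 𝕜] {p : ℕ} (lam : ℝ)

/-- The contribution of one sample to the covariance estimator, which is the average of these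
matrices over all samples. -/
noncomputable def sampleMatrix (y τ τ' : Fin p → 𝕜) : Matrix (Fin p) (Fin p) 𝕜 :=
  (lam ^ 2 / 2) • (outer (quantize y τ) (quantize y τ') + outer (quantize y τ') (quantize y τ))

theorem isHermitian_sampleMatrix (y τ τ' : Fin p → 𝕜) :
    (sampleMatrix lam y τ τ').IsHermitian := by
  rw [IsHermitian, sampleMatrix, conjTranspose_smul, conjTranspose_add, conjTranspose_outer,
    conjTranspose_outer, add_comm, star_trivial]

theorem estimator_eq_smul_sum_sampleMatrix {n : ℕ} (y τ τ' : Fin n → Fin p → 𝕜) :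
    estimator lam y τ τ' = (1 / n : ℝ) • ∑ k, sampleMatrix lam (y k) (τ k) (τ' k) := by
  simp only [estimator, asymEstimator, sampleMatrix, conjTranspose_smul, conjTranspose_sum,
    conjTranspose_outer, RCLike.star_def, RCLike.conj_ofReal, ← Finset.smul_sum, smul_smul,
    ← smul_add, ← Finset.sum_add_distrib, ← RCLike.ofReal_mul,
    RCLike.real_smul_eq_coe_smul (K := 𝕜)]
  congr 2
  ring

theorem sum_norm_quantize_sq_le (y τ : Fin p → 𝕜) : ∑ i, ‖quantize y τ i‖ ^ 2 ≤ 2 * p := by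
  refine (Finset.sum_le_sum fun i _ => norm_signF_sq_le _).trans (le_of_eq ?_)
  rw [Finset.sum_const, Finset.card_univ, Fintype.card_fin, nsmul_eq_mul, mul_comm]

theorem outer_quantize_self_le (y τ : Fin p → 𝕜) :
    outer (quantize y τ) (quantize y τ) ≤ (2 * p : ℝ) • 1 := by
  refine (le_re_trace_smul_one (outer_self_nonneg _)).trans ?_
  rw [re_trace_outer_self]
  exact smul_le_smul_of_nonneg_right (sum_norm_quantize_sq_le y τ) zero_le_one

theorem norm_sampleMatrix_le [NeZero p] (y τ τ' : Fin p → 𝕜) :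
    ‖sampleMatrix lam y τ τ'‖ ≤ 2 * p * lam ^ 2 := by
  have hsum : outer (quantize y τ) (quantize y τ) + outer (quantize y τ') (quantize y τ') ≤
      (4 * p : ℝ) • 1 := by
    convert add_le_add (outer_quantize_self_le y τ) (outer_quantize_self_le y τ') using 1
    rw [← add_smul]
    ring_nf
  have hscale : (2 * p * lam ^ 2) • (1 : Matrix (Fin p) (Fin p) 𝕜) =
      (lam ^ 2 / 2) • (4 * p : ℝ) • 1 := by
    rw [smul_smul]
    ring_nf
  refine norm_le_of_neg_le_of_le (isHermitian_sampleMatrix lam y τ τ') ?_ ?_ <;>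
    rw [hscale, sampleMatrix]
  · rw [← smul_neg]
    refine smul_le_smul_of_nonneg_left (le_trans ?_ hsum) (by positivity)
    simpa using neg_outer_add_outer_le one_pos (quantize y τ) (quantize y τ')
  · refine smul_le_smul_of_nonneg_left (le_trans ?_ hsum) (by positivity)
    simpa using outer_add_outer_le one_pos (quantize y τ) (quantize y τ')

theorem outer_quantize_mul_outer_quantize_le (y τ τ' : Fin p → 𝕜) :
    outer (quantize y τ) (quantize y τ') * outer (quantize y τ') (quantize y τ) ≤
      (2 * p : ℝ) • outer (quantize y τ) (quantize y τ) := by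
  rw [outer_mul_outer, star_dotProduct_self, ← RCLike.real_smul_eq_coe_smul]
  exact smul_le_smul_of_nonneg_right (sum_norm_quantize_sq_le y τ') (outer_self_nonneg _)

theorem sampleMatrix_mul_self_le (y τ τ' : Fin p → 𝕜) :
    sampleMatrix lam y τ τ' * sampleMatrix lam y τ τ' ≤ (p * lam ^ 4) •
      (outer (quantize y τ) (quantize y τ) + outer (quantize y τ') (quantize y τ')) := by
  have hsq := mul_self_add_conjTranspose_le (outer (quantize y τ) (quantize y τ'))
  rw [conjTranspose_outer] at hsq
  have hle := add_le_add (outer_quantize_mul_outer_quantize_le y τ τ')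
    (outer_quantize_mul_outer_quantize_le y τ' τ)
  rw [← smul_add] at hle
  have hscale : (p * lam ^ 4) = (lam ^ 2 / 2) * (lam ^ 2 / 2) * (2 * (2 * p)) := by ring
  rw [sampleMatrix, smul_mul_smul_comm, hscale, ← smul_smul _ (2 * (2 * p : ℝ)),
    ← smul_smul 2]
  exact smul_le_smul_of_nonneg_left
    (hsq.trans (smul_le_smul_of_nonneg_left hle zero_le_two)) (by positivity)

theorem continuous_outer :
    Continuous fun z : (Fin p → 𝕜) × (Fin p → 𝕜) => outer z.1 z.2 :=
  continuous_fst.matrix_vecMulVec continuous_snd.star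

theorem measurable_outer_quantize {α : Type*} [MeasurableSpace α] {f g h : α → Fin p → 𝕜}
    (hf : Measurable f) (hg : Measurable g) (hh : Measurable h) :
    Measurable fun a => outer (quantize (f a) (g a)) (quantize (f a) (h a)) :=
  continuous_outer.measurable.comp ((measurable_quantize.comp (hf.prodMk hg)).prodMk
    (measurable_quantize.comp (hf.prodMk hh)))

theorem measurable_sampleMatrix {α : Type*} [MeasurableSpace α] {f g h : α → Fin p → 𝕜}
    (hf : Measurable f) (hg : Measurable g) (hh : Measurable h) :
    Measurable fun a => sampleMatrix lam (f a) (g a) (h a) :=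
  ((measurable_outer_quantize hf hg hh).add (measurable_outer_quantize hf hh hg)).const_smul
    (lam ^ 2 / 2)

end SampleMatrix

section OneSample

open Matrix
open scoped Matrix.Norms.L2Operator MatrixOrder ComplexOrder

attribute [local instance] matrixNormedAlgebraReal matrixMeasurableSpace matrix_borelSpace
  matrix_secondCountableTopology matrix_orderClosedTopology

variable {𝕜 : Type*} [RCLike 𝕜] {p : ℕ} {Ω : Type*} [MeasurableSpace Ω] {μ : Measure Ω}
  {lam ζ : ℝ} {y τ τ' : Ω → Fin p → 𝕜}

/-- `τ` and `τ'` are dithering vectors for the random vector `y`: they have the dither law, and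
`y`, `τ`, `τ'` are independent. -/
def IsDithered (μ : Measure Ω) (lam : ℝ) (y τ τ' : Ω → Fin p → 𝕜) : Prop :=
  μ.map (fun ω => (y ω, (τ ω, τ' ω))) =
    (μ.map y).prod ((ditherVecLaw 𝕜 p lam).prod (ditherVecLaw 𝕜 p lam))

theorem IsDithered.integral_eq [IsFiniteMeasure μ] {E : Type*} [NormedAddCommGroup E]
    [NormedSpace ℝ E] (h : IsDithered μ lam y τ τ') (hlam : 0 < lam) (hy : Measurable y)
    (hτ : Measurable τ) (hτ' : Measurable τ')
    {G : (Fin p → 𝕜) × ((Fin p → 𝕜) × (Fin p → 𝕜)) → E} (hG : StronglyMeasurable G) {c : ℝ}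
    (hc : ∀ z, ‖G z‖ ≤ c) :
    ∫ ω, G (y ω, (τ ω, τ' ω)) ∂μ = ∫ ω, ∫ z, G (y ω, z)
      ∂((ditherVecLaw 𝕜 p lam).prod (ditherVecLaw 𝕜 p lam)) ∂μ := by
  have := isProbabilityMeasure_ditherVecLaw (𝕜 := 𝕜) hlam p
  rw [← integral_map (φ := fun ω => (y ω, (τ ω, τ' ω)))
    (hy.prodMk (hτ.prodMk hτ')).aemeasurable hG.aestronglyMeasurable, h,
    integral_prod _ (.of_bound hG.aestronglyMeasurable c (.of_forall hc)),
    integral_map hy.aemeasurable hG.integral_prod_right'.aestronglyMeasurable]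

theorem IsDithered.swap [IsFiniteMeasure μ] (h : IsDithered μ lam y τ τ') (hlam : 0 < lam)
    (hy : Measurable y) (hτ : Measurable τ) (hτ' : Measurable τ') :
    IsDithered μ lam y τ' τ := by
  have := isProbabilityMeasure_ditherVecLaw (𝕜 := 𝕜) hlam p
  have hmap := congr_arg (Measure.map (Prod.map id Prod.swap)) h
  rw [Measure.map_map (measurable_id.prodMap measurable_swap) (hy.prodMk (hτ.prodMk hτ')),
    ← Measure.map_prod_map _ _ measurable_id measurable_swap, Measure.map_id,
    Measure.prod_swap] at hmap
  exact hmap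

theorem integral_outer_quantize (hlam : 0 < lam) (y : Fin p → 𝕜) :
    lam ^ 2 • ∫ z, outer (quantize y z.1) (quantize y z.2)
        ∂((ditherVecLaw 𝕜 p lam).prod (ditherVecLaw 𝕜 p lam)) =
      outer (clip lam ∘ y) (clip lam ∘ y) := by
  have := isProbabilityMeasure_ditherVecLaw (𝕜 := 𝕜) hlam p
  have hlam0 : (lam : 𝕜) ≠ 0 := RCLike.ofReal_ne_zero.2 hlam.ne'
  have hint := integrable_outer
    (μ := (ditherVecLaw 𝕜 p lam).prod (ditherVecLaw 𝕜 p lam))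
    (fun i => memLp_quantize (y := fun _ => y) measurable_const measurable_fst i)
    fun i => memLp_quantize (y := fun _ => y) measurable_const measurable_snd i
  ext i j
  rw [Matrix.smul_apply, integral_matrix_apply hint]
  simp only [outer_apply, RCLike.star_def]
  rw [integral_prod_mul (fun τ => quantize y τ i) fun τ => (starRingEnd 𝕜) (quantize y τ j),
    integral_conj, integral_quantize hlam, integral_quantize hlam, RCLike.real_smul_eq_coe_mul]
  simp only [map_div₀, RCLike.conj_ofReal, Function.comp_apply, RCLike.ofReal_pow]
  field_simp

theorem integral_sampleMatrix_prod (hlam : 0 < lam) (y : Fin p → 𝕜) :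
    ∫ z, sampleMatrix lam y z.1 z.2 ∂((ditherVecLaw 𝕜 p lam).prod (ditherVecLaw 𝕜 p lam)) =
      outer (clip lam ∘ y) (clip lam ∘ y) := by
  have := isProbabilityMeasure_ditherVecLaw (𝕜 := 𝕜) hlam p
  have hint := integrable_outer
    (μ := (ditherVecLaw 𝕜 p lam).prod (ditherVecLaw 𝕜 p lam))
    (fun i => memLp_quantize (y := fun _ => y) measurable_const measurable_fst i)
    fun i => memLp_quantize (y := fun _ => y) measurable_const measurable_snd i
  have hint' : Integrable (fun z => outer (quantize y z.2) (quantize y z.1))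
      ((ditherVecLaw 𝕜 p lam).prod (ditherVecLaw 𝕜 p lam)) := hint.swap
  have hswap := integral_prod_swap (μ := ditherVecLaw 𝕜 p lam) (ν := ditherVecLaw 𝕜 p lam)
    fun z => outer (quantize y z.1) (quantize y z.2)
  simp only [Prod.fst_swap, Prod.snd_swap] at hswap
  simp only [sampleMatrix]
  rw [integral_smul, integral_add hint hint', hswap, ← two_smul ℝ, smul_smul,
    div_mul_cancel₀ _ two_ne_zero, integral_outer_quantize hlam]

theorem memLp_clip [IsFiniteMeasure μ] (hlam : 0 ≤ lam) (hy : Measurable y) (i : Fin p) :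
    MemLp (fun ω => (clip lam ∘ y ω) i) 2 μ :=
  .of_bound (measurable_clip.comp ((measurable_pi_apply i).comp hy)).aestronglyMeasurable
    (2 * lam) (.of_forall fun _ => norm_clip_le hlam _)

theorem IsDithered.integral_sampleMatrix [IsFiniteMeasure μ] [NeZero p]
    (h : IsDithered μ lam y τ τ') (hlam : 0 < lam) (hy : Measurable y) (hτ : Measurable τ)
    (hτ' : Measurable τ') :
    ∫ ω, sampleMatrix lam (y ω) (τ ω) (τ' ω) ∂μ = secondMoment μ fun ω => clip lam ∘ y ω := by
  rw [h.integral_eq hlam hy hτ hτ' (G := fun z => sampleMatrix lam z.1 z.2.1 z.2.2)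
    (measurable_sampleMatrix lam measurable_fst measurable_snd.fst
      measurable_snd.snd).stronglyMeasurable (fun z => norm_sampleMatrix_le lam _ _ _),
    secondMoment_eq_integral (memLp_clip hlam.le hy)]
  simp only [integral_sampleMatrix_prod hlam]

theorem norm_outer_quantize_self_le [NeZero p] (y τ : Fin p → 𝕜) :
    ‖outer (quantize y τ) (quantize y τ)‖ ≤ 2 * p := by
  refine norm_le_of_neg_le_of_le (nonneg_iff_posSemidef.1 (outer_self_nonneg _)).isHermitian ?_
    (outer_quantize_self_le y τ)
  exact (neg_nonpos.2 (outer_self_nonneg _)).trans (smul_nonneg (by positivity) zero_le_one)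

theorem IsDithered.integral_outer_quantize_self_le [IsProbabilityMeasure μ] [NeZero p]
    (h : IsDithered μ lam y τ τ') (hlam : 0 < lam) (hy : Measurable y) (hτ : Measurable τ)
    (hτ' : Measurable τ') :
    lam ^ 2 • ∫ ω, outer (quantize (y ω) (τ ω)) (quantize (y ω) (τ ω)) ∂μ ≤
      secondMoment μ (fun ω => clip lam ∘ y ω) + (2 * lam ^ 2) • 1 := by
  have := isProbabilityMeasure_ditherVecLaw (𝕜 := 𝕜) hlam p
  have hclip := integrable_outer (memLp_clip (μ := μ) hlam.le hy) (memLp_clip hlam.le hy)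
  have hmeas : Measurable fun z : (Fin p → 𝕜) × (Fin p → 𝕜) × (Fin p → 𝕜) =>
      outer (quantize z.1 z.2.1) (quantize z.1 z.2.1) :=
    measurable_outer_quantize measurable_fst measurable_snd.fst measurable_snd.fst
  have hinner : Integrable (fun ω => ∫ σ, outer (quantize (y ω) σ) (quantize (y ω) σ)
      ∂ditherVecLaw 𝕜 p lam) μ := by
    refine .of_bound ?_ (2 * p) (.of_forall fun ω => ?_)
    · have hjoint : Measurable fun z : Ω × (Fin p → 𝕜) =>
          outer (quantize (y z.1) z.2) (quantize (y z.1) z.2) :=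
        measurable_outer_quantize (hy.comp measurable_fst) measurable_snd measurable_snd
      exact hjoint.stronglyMeasurable.integral_prod_right'.aestronglyMeasurable
    · refine (norm_integral_le_of_norm_le_const (.of_forall fun σ =>
        norm_outer_quantize_self_le _ _)).trans ?_
      simp
  rw [h.integral_eq hlam hy hτ hτ' hmeas.stronglyMeasurable
    (fun z => norm_outer_quantize_self_le _ _), secondMoment_eq_integral (memLp_clip hlam.le hy)]
  have hfst : ∀ w : Fin p → 𝕜, ∫ z, outer (quantize w z.1) (quantize w z.1)
      ∂((ditherVecLaw 𝕜 p lam).prod (ditherVecLaw 𝕜 p lam)) =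
      ∫ σ, outer (quantize w σ) (quantize w σ) ∂ditherVecLaw 𝕜 p lam := fun w => by
    rw [integral_fun_fst fun σ => outer (quantize w σ) (quantize w σ), probReal_univ, one_smul]
  simp only [hfst]
  calc lam ^ 2 • ∫ ω, ∫ σ, outer (quantize (y ω) σ) (quantize (y ω) σ) ∂ditherVecLaw 𝕜 p lam ∂μ
      = ∫ ω, lam ^ 2 • ∫ σ, outer (quantize (y ω) σ) (quantize (y ω) σ)
          ∂ditherVecLaw 𝕜 p lam ∂μ := (integral_smul _ _).symm
    _ ≤ ∫ ω, (outer (clip lam ∘ y ω) (clip lam ∘ y ω) + (2 * lam ^ 2) • 1) ∂μ :=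
        integral_mono (hinner.fun_smul _) (hclip.add (integrable_const _)) fun ω =>
          OneBitCov.integral_outer_quantize_self_le hlam (y ω)
    _ = ∫ ω, outer (clip lam ∘ y ω) (clip lam ∘ y ω) ∂μ + (2 * lam ^ 2) • 1 := by
        rw [integral_add hclip (integrable_const _), integral_const, probReal_univ, one_smul]

theorem secondMoment_clip_le [IsFiniteMeasure μ] (hlam : 0 ≤ lam) (hy : Measurable y)
    (hyL : ∀ i, MemLp (fun ω => y ω i) 2 μ)
    (hζ : ∫ ω, ∑ i, ‖(y ω - clip lam ∘ y ω) i‖ ^ 2 ∂μ ≤ ζ) :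
    secondMoment μ (fun ω => clip lam ∘ y ω) ≤ (2 * (opNorm (secondMoment μ y) + ζ)) • 1 := by
  have hzL : ∀ i, MemLp (fun ω => (y ω - clip lam ∘ y ω) i) 2 μ := fun i =>
    (hyL i).sub (memLp_clip hlam hy i)
  have hle := secondMoment_sub_le hyL hzL one_pos
  simp only [sub_sub_cancel, inv_one, one_add_one_eq_two, ← smul_add] at hle
  refine hle.trans ?_
  rw [mul_smul, add_smul]
  exact smul_le_smul_of_nonneg_left (add_le_add (secondMoment_le_opNorm_smul_one hyL)
    (secondMoment_le_smul_one hzL hζ)) zero_le_two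

theorem IsDithered.integral_sampleMatrix_mul_self_le [IsProbabilityMeasure μ] [NeZero p]
    (h : IsDithered μ lam y τ τ') (hlam : 0 < lam) (hy : Measurable y) (hτ : Measurable τ)
    (hτ' : Measurable τ') (hyL : ∀ i, MemLp (fun ω => y ω i) 2 μ)
    (hζ : ∫ ω, ∑ i, ‖(y ω - clip lam ∘ y ω) i‖ ^ 2 ∂μ ≤ ζ) :
    ∫ ω, sampleMatrix lam (y ω) (τ ω) (τ' ω) * sampleMatrix lam (y ω) (τ ω) (τ' ω) ∂μ ≤
      (4 * p * lam ^ 2 * (opNorm (secondMoment μ y) + ζ + lam ^ 2)) • 1 := by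
  have hquant : ∀ {σ : Ω → Fin p → 𝕜}, Measurable σ →
      Integrable (fun ω => outer (quantize (y ω) (σ ω)) (quantize (y ω) (σ ω))) μ := fun hσ =>
    integrable_outer (memLp_quantize hy hσ) (memLp_quantize hy hσ)
  have hmeas := measurable_sampleMatrix lam hy hτ hτ'
  have hsq : Integrable (fun ω =>
      sampleMatrix lam (y ω) (τ ω) (τ' ω) * sampleMatrix lam (y ω) (τ ω) (τ' ω)) μ :=
    integrable_of_norm_le (hmeas.mul hmeas) (r := (2 * p * lam ^ 2) * (2 * p * lam ^ 2)) fun ω =>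
      (norm_mul_le _ _).trans (by gcongr <;> exact norm_sampleMatrix_le lam _ _ _)
  have hone : ∀ {σ : Ω → Fin p → 𝕜}, lam ^ 2 • ∫ ω, outer (quantize (y ω) (σ ω))
        (quantize (y ω) (σ ω)) ∂μ ≤
        secondMoment μ (fun ω => clip lam ∘ y ω) + (2 * lam ^ 2) • 1 →
      lam ^ 2 • ∫ ω, outer (quantize (y ω) (σ ω)) (quantize (y ω) (σ ω)) ∂μ ≤
        (2 * (opNorm (secondMoment μ y) + ζ + lam ^ 2)) • 1 := fun hσ => by
    rw [mul_add, add_smul]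
    exact hσ.trans (add_le_add_left (secondMoment_clip_le hlam.le hy hyL hζ) _)
  calc ∫ ω, sampleMatrix lam (y ω) (τ ω) (τ' ω) * sampleMatrix lam (y ω) (τ ω) (τ' ω) ∂μ
      ≤ ∫ ω, (p * lam ^ 4) • (outer (quantize (y ω) (τ ω)) (quantize (y ω) (τ ω)) +
          outer (quantize (y ω) (τ' ω)) (quantize (y ω) (τ' ω))) ∂μ :=
        integral_mono hsq (((hquant hτ).add (hquant hτ')).fun_smul _) fun ω =>
          sampleMatrix_mul_self_le lam _ _ _
    _ = (p * lam ^ 2) •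
          (lam ^ 2 • ∫ ω, outer (quantize (y ω) (τ ω)) (quantize (y ω) (τ ω)) ∂μ +
          lam ^ 2 • ∫ ω, outer (quantize (y ω) (τ' ω)) (quantize (y ω) (τ' ω)) ∂μ) := by
        rw [integral_smul, integral_add (hquant hτ) (hquant hτ'), ← smul_add, smul_smul]
        ring_nf
    _ ≤ (p * lam ^ 2) • ((2 * (opNorm (secondMoment μ y) + ζ + lam ^ 2)) • 1 +
          (2 * (opNorm (secondMoment μ y) + ζ + lam ^ 2)) • 1) :=
        smul_le_smul_of_nonneg_left (add_le_add
          (hone (h.integral_outer_quantize_self_le hlam hy hτ hτ'))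
          (hone ((h.swap hlam hy hτ hτ').integral_outer_quantize_self_le hlam hy hτ' hτ)))
          (by positivity)
    _ = (4 * p * lam ^ 2 * (opNorm (secondMoment μ y) + ζ + lam ^ 2)) • 1 := by
        rw [← add_smul, smul_smul]
        ring_nf

end OneSample

section CenteredBernstein

open Matrix
open scoped Matrix.Norms.L2Operator MatrixOrder ComplexOrder

attribute [local instance] matrixNormedAlgebraReal matrixMeasurableSpace matrix_borelSpace
  matrix_secondCountableTopology matrix_orderClosedTopology

variable {𝕜 : Type*} [RCLike 𝕜] {m : Type*} [Fintype m] [DecidableEq m] {Ω : Type*}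
  [MeasurableSpace Ω] {μ : Measure Ω}

theorem isHermitian_integral {X : Ω → Matrix m m 𝕜} (hX : ∀ ω, (X ω).IsHermitian) :
    (∫ ω, X ω ∂μ).IsHermitian := by
  rw [IsHermitian, ← integral_conjTranspose]
  simp only [(hX _).eq]

theorem integral_sub_integral_mul_self_le [IsProbabilityMeasure μ] {X : Ω → Matrix m m 𝕜}
    (hX : Integrable X μ) (hXX : Integrable (fun ω => X ω * X ω) μ)
    (hherm : ∀ ω, (X ω).IsHermitian) :
    ∫ ω, (X ω - ∫ x, X x ∂μ) * (X ω - ∫ x, X x ∂μ) ∂μ ≤ ∫ ω, X ω * X ω ∂μ := by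
  set M := ∫ x, X x ∂μ with hM
  have hMM : 0 ≤ M * M := by
    convert (posSemidef_self_mul_conjTranspose M).nonneg
    exact (isHermitian_integral hherm).eq.symm
  have hcross : Integrable (fun ω => X ω * M + M * X ω) μ :=
    (hX.mul_const M).add (hX.const_mul M)
  have hdiff : Integrable (fun ω => X ω * X ω - (X ω * M + M * X ω)) μ := hXX.sub hcross
  have hexpand : ∀ ω, (X ω - M) * (X ω - M) = X ω * X ω - (X ω * M + M * X ω) + M * M :=
    fun ω => by noncomm_ring
  simp only [hexpand]
  rw [integral_add hdiff (integrable_const _), integral_sub hXX hcross,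
    integral_add (hX.mul_const M) (hX.const_mul M), integral_mul_const_of_integrable hX,
    integral_const_mul_of_integrable hX, ← hM, integral_const, probReal_univ, one_smul]
  convert sub_le_self _ hMM using 1
  abel

theorem matrix_bernstein_centered [IsProbabilityMeasure μ] [Nonempty m] {ι : Type*} [Fintype ι]
    {X : ι → Ω → Matrix m m 𝕜} {w : ι → ℝ} {R L : ℝ} (hX : ∀ k, Measurable (X k))
    (hind : iIndepFun X μ) (hherm : ∀ k ω, (X k ω).IsHermitian) (hR : 0 < R)
    (hbd : ∀ k ω, ‖X k ω‖ ≤ R) (hvar : ∀ k, ∫ ω, X k ω * X k ω ∂μ ≤ w k • 1) (hL : 0 ≤ L) :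
    μ.real {ω | 2 * √((∑ k, w k) * L) + 4 * R * L ≤ ‖∑ k, (X k ω - ∫ x, X k x ∂μ)‖} ≤
      2 * Fintype.card m * Real.exp (-L) := by
  have hint : ∀ k, Integrable (X k) μ := fun k => integrable_of_norm_le (hX k) (hbd k)
  have hsq : ∀ k, Integrable (fun ω => X k ω * X k ω) μ := fun k =>
    integrable_of_norm_le ((hX k).mul (hX k)) (r := R * R) fun ω =>
      (norm_mul_le _ _).trans (by gcongr <;> exact hbd k ω)
  have hmean : ∀ k, ‖∫ x, X k x ∂μ‖ ≤ R := fun k => by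
    simpa using norm_integral_le_of_norm_le_const (μ := μ) (.of_forall (hbd k))
  have hbernstein := matrix_bernstein (μ := μ) (Y := fun k ω => X k ω - ∫ x, X k x ∂μ)
    (fun k => (hX k).sub_const _)
    (hind.comp (fun k A => A - ∫ x, X k x ∂μ) fun k => measurable_id.sub_const _)
    (fun k ω => (hherm k ω).sub (isHermitian_integral (hherm k))) (R := 2 * R) (by positivity)
    (fun k ω => (norm_sub_le _ _).trans ((add_le_add (hbd k ω) (hmean k)).trans_eq (by ring)))
    (fun k => by
      rw [integral_sub (hint k) (integrable_const _), integral_const, probReal_univ, one_smul,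
        sub_self])
    (fun k => (integral_sub_integral_mul_self_le (hint k) (hsq k) (hherm k)).trans (hvar k)) hL
  convert hbernstein using 6
  ring

end CenteredBernstein

section Numerics

variable {lam C ζ r a : ℝ}

theorem sqrt_variance_le (hlam : 0 ≤ lam) (hC : 0 ≤ C) (hζ0 : 0 ≤ ζ) (hr : 0 ≤ r)
    (hζ : ζ ≤ 12 * lam ^ 2 * r) (ha : a ≤ 2 * r) :
    √(4 * lam ^ 2 * (C + ζ + lam ^ 2) * a) ≤ 3 * (lam * √r) * (√C + 4 * (lam * √r) + lam) := by
  have hx : 0 ≤ lam * √r := by positivity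
  have hxr : (lam * √r) ^ 2 = lam ^ 2 * r := by rw [mul_pow, Real.sq_sqrt hr]
  have hCsq : √C ^ 2 = C := Real.sq_sqrt hC
  have hC' := Real.sqrt_nonneg C
  rw [Real.sqrt_le_left (by positivity)]
  calc 4 * lam ^ 2 * (C + ζ + lam ^ 2) * a
      ≤ 4 * lam ^ 2 * (C + ζ + lam ^ 2) * (2 * r) := by gcongr
    _ ≤ 4 * lam ^ 2 * (C + 12 * lam ^ 2 * r + lam ^ 2) * (2 * r) := by gcongr
    _ = 8 * (lam * √r) ^ 2 * (√C ^ 2 + 12 * (lam * √r) ^ 2 + lam ^ 2) := by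
        rw [hxr, hCsq]
        ring
    _ ≤ 9 * (lam * √r) ^ 2 * (√C + 4 * (lam * √r) + lam) ^ 2 := by
        gcongr
        · norm_num
        · nlinarith [mul_nonneg hC' hx, mul_nonneg hC' hlam, mul_nonneg hx hlam,
            sq_nonneg (lam * √r)]
    _ = (3 * (lam * √r) * (√C + 4 * (lam * √r) + lam)) ^ 2 := by ring

theorem bias_le (hlam : 0 ≤ lam) (hr : 0 ≤ r) (hζ : ζ ≤ 12 * lam ^ 2 * r) :
    2 * (√C * √ζ) + ζ ≤ 8 * (lam * √C * √r) + 12 * (lam ^ 2 * r) := by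
  have hsqrt : √ζ ≤ 4 * (lam * √r) := by
    rw [Real.sqrt_le_left (by positivity), mul_pow, mul_pow, Real.sq_sqrt hr]
    nlinarith [mul_nonneg (sq_nonneg lam) hr]
  nlinarith [mul_le_mul_of_nonneg_left hsqrt (Real.sqrt_nonneg C)]

theorem deviation_add_bias_le (hlam : 0 ≤ lam) (hC : 0 ≤ C) (hζ0 : 0 ≤ ζ) (hr : 0 ≤ r)
    (hζ : ζ ≤ 12 * lam ^ 2 * r) (ha : a ≤ 2 * r) :
    2 * √(4 * lam ^ 2 * (C + ζ + lam ^ 2) * a) + 8 * lam ^ 2 * a + (2 * (√C * √ζ) + ζ) ≤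
      64 * ((lam * √C + lam ^ 2) * √r + lam ^ 2 * r) := by
  have hvariance := sqrt_variance_le hlam hC hζ0 hr hζ ha
  have hbias := bias_le (C := C) hlam hr hζ
  have hrange : lam ^ 2 * a ≤ lam ^ 2 * (2 * r) := by gcongr
  have hsq : lam ^ 2 * √r ^ 2 = lam ^ 2 * r := by rw [Real.sq_sqrt hr]
  have hcross : 0 ≤ lam * √C * √r := by positivity
  have hlinear : 0 ≤ lam ^ 2 * √r := by positivity
  have hquad : 0 ≤ lam ^ 2 * r := by positivity
  nlinarith

theorem log_two_le_log_add {p t : ℝ} (hp : 1 ≤ p) (ht : 0 ≤ t) (hpt : 2 ≤ p ∨ 1 ≤ t) :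
    Real.log 2 ≤ Real.log p + t := by
  rcases hpt with hp2 | ht1
  · linarith [Real.log_le_log two_pos hp2]
  · linarith [Real.log_nonneg hp, Real.log_two_lt_d9]

end Numerics

section Concentration

open Matrix
open scoped Matrix.Norms.L2Operator MatrixOrder ComplexOrder

attribute [local instance] matrixNormedAlgebraReal matrixMeasurableSpace matrix_borelSpace
  matrix_secondCountableTopology matrix_orderClosedTopology

variable {𝕜 : Type*} [RCLike 𝕜] {n p : ℕ} {Ω : Type*} [MeasurableSpace Ω] {μ : Measure Ω}
  {lam L C ζ t : ℝ} {y τ τ' : Fin n → Ω → Fin p → 𝕜}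

theorem opNorm_estimator_sub_le (hn : 0 < n) (lam : ℝ) (v τ τ' : Fin n → Fin p → 𝕜)
    (M S : Fin n → Matrix (Fin p) (Fin p) 𝕜) {β : ℝ} (hβ : ∀ k, ‖M k - S k‖ ≤ β) :
    opNorm (estimator lam v τ τ' - (n : 𝕜)⁻¹ • ∑ k, S k) ≤
      ‖∑ k, (sampleMatrix lam (v k) (τ k) (τ' k) - M k)‖ / n + β := by
  have hn0 : (0 : ℝ) < n := Nat.cast_pos.2 hn
  have hinv : (n : 𝕜)⁻¹ = ((1 / n : ℝ) : 𝕜) := by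
    rw [one_div, RCLike.ofReal_inv, RCLike.ofReal_natCast]
  have hsplit : estimator lam v τ τ' - (n : 𝕜)⁻¹ • ∑ k, S k =
      (1 / n : ℝ) • (∑ k, (sampleMatrix lam (v k) (τ k) (τ' k) - M k) + ∑ k, (M k - S k)) := by
    rw [estimator_eq_smul_sum_sampleMatrix, hinv, ← RCLike.real_smul_eq_coe_smul, ← smul_sub,
      ← Finset.sum_add_distrib, ← Finset.sum_sub_distrib]
    simp only [sub_add_sub_cancel]
  have hbias : ‖∑ k, (M k - S k)‖ ≤ n * β := by
    exact (norm_sum_le_of_le _ fun k _ => hβ k).trans_eq (by simp)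
  calc ‖estimator lam v τ τ' - (n : 𝕜)⁻¹ • ∑ k, S k‖
      ≤ (1 / n : ℝ) * (‖∑ k, (sampleMatrix lam (v k) (τ k) (τ' k) - M k)‖ + n * β) := by
        rw [hsplit, norm_smul, Real.norm_of_nonneg (by positivity)]
        gcongr
        exact (norm_add_le _ _).trans (add_le_add_right hbias _)
    _ = ‖∑ k, (sampleMatrix lam (v k) (τ k) (τ' k) - M k)‖ / n + β := by field_simp

theorem one_sub_le_measureReal_of_compl_subset [IsProbabilityMeasure μ] {A B : Set Ω} {δ : ℝ}
    (hA : μ.real A ≤ δ) (hBA : Bᶜ ⊆ A) : 1 - δ ≤ μ.real B := by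
  have huniv : 1 ≤ μ.real B + μ.real Bᶜ := by
    rw [← probReal_univ (μ := μ), ← Set.union_compl_self B]
    exact measureReal_union_le _ _
  linarith [measureReal_mono (μ := μ) hBA]

theorem measureReal_le_norm_sum_sampleMatrix_sub_le [IsProbabilityMeasure μ] [NeZero p]
    (hlam : 0 < lam) (hL : 0 ≤ L) (hy : ∀ k, Measurable (y k)) (hτ : ∀ k, Measurable (τ k))
    (hτ' : ∀ k, Measurable (τ' k)) (hyL : ∀ k i, MemLp (fun ω => y k ω i) 2 μ)
    (hdith : ∀ k, IsDithered μ lam (y k) (τ k) (τ' k))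
    (hind : iIndepFun (fun k ω => (y k ω, (τ k ω, τ' k ω))) μ)
    (hζ : ∀ k, ∫ ω, ∑ i, ‖(y k ω - clip lam ∘ y k ω) i‖ ^ 2 ∂μ ≤ ζ)
    (hC : ∀ k, opNorm (secondMoment μ (y k)) ≤ C) :
    μ.real {ω | 2 * √(n * (4 * p * lam ^ 2 * (C + ζ + lam ^ 2)) * L) +
        8 * p * lam ^ 2 * L ≤ ‖∑ k, (sampleMatrix lam (y k ω) (τ k ω) (τ' k ω) -
          secondMoment μ fun ω => clip lam ∘ y k ω)‖} ≤ 2 * p * Real.exp (-L) := by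
  have hp : (0 : ℝ) < p := Nat.cast_pos.2 (Nat.pos_of_neZero p)
  have hvar : ∀ k, ∫ ω, sampleMatrix lam (y k ω) (τ k ω) (τ' k ω) *
      sampleMatrix lam (y k ω) (τ k ω) (τ' k ω) ∂μ ≤
        (4 * p * lam ^ 2 * (C + ζ + lam ^ 2)) • 1 := fun k => by
    refine ((hdith k).integral_sampleMatrix_mul_self_le hlam (hy k) (hτ k) (hτ' k) (hyL k)
      (hζ k)).trans (smul_le_smul_of_nonneg_right ?_ zero_le_one)
    gcongr
    exact hC k
  have hmean : ∀ k, ∫ ω, sampleMatrix lam (y k ω) (τ k ω) (τ' k ω) ∂μ =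
      secondMoment μ fun ω => clip lam ∘ y k ω := fun k =>
    (hdith k).integral_sampleMatrix hlam (hy k) (hτ k) (hτ' k)
  have hbernstein := matrix_bernstein_centered
    (fun k => measurable_sampleMatrix lam (hy k) (hτ k) (hτ' k))
    (hind.comp (fun _ z => sampleMatrix lam z.1 z.2.1 z.2.2) fun _ =>
      measurable_sampleMatrix lam measurable_fst measurable_snd.fst measurable_snd.snd)
    (fun k ω => isHermitian_sampleMatrix lam _ _ _) (R := 2 * p * lam ^ 2) (by positivity)
    (fun k ω => norm_sampleMatrix_le lam _ _ _) hvar hL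
  simp only [hmean, Finset.sum_const, Finset.card_univ, Fintype.card_fin, nsmul_eq_mul]
    at hbernstein
  convert hbernstein using 5
  ring

theorem opNorm_secondMoment_clip_sub_le [IsFiniteMeasure μ] [NeZero p] {y : Ω → Fin p → 𝕜}
    (hlam : 0 ≤ lam) (hy : Measurable y) (hyL : ∀ i, MemLp (fun ω => y ω i) 2 μ)
    (hζ : ∫ ω, ∑ i, ‖(y ω - clip lam ∘ y ω) i‖ ^ 2 ∂μ ≤ ζ)
    (hC : opNorm (secondMoment μ y) ≤ C) :
    opNorm (secondMoment μ (fun ω => clip lam ∘ y ω) - secondMoment μ y) ≤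
      2 * (√C * √ζ) + ζ := by
  have hclip : (fun ω => clip lam ∘ y ω) = fun ω => y ω - (y ω - clip lam ∘ y ω) := by
    simp only [sub_sub_cancel]
  rw [hclip]
  refine (opNorm_secondMoment_sub_le hyL (fun i => (hyL i).sub (memLp_clip hlam hy i)) hζ).trans ?_
  gcongr

theorem opNorm_secondMoment_le_Cop (y : Fin n → Ω → Fin p → 𝕜) (k : Fin n) :
    opNorm (secondMoment μ (y k)) ≤ Cop μ y :=
  le_ciSup (f := fun k => opNorm (secondMoment μ (y k))) (Set.finite_range _).bddAbove k

theorem Cop_nonneg (y : Fin n → Ω → Fin p → 𝕜) : 0 ≤ Cop μ y :=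
  Real.iSup_nonneg fun _ => norm_nonneg _

theorem rate_nonneg (hp : 1 ≤ p) (ht : 0 ≤ t) : 0 ≤ rate n p t := by
  have hlog := Real.log_nonneg (Nat.one_le_cast.2 hp : (1 : ℝ) ≤ p)
  unfold rate
  positivity

theorem estError_le_of_truncation_of_measurable [IsProbabilityMeasure μ]
    {S : Matrix (Fin p) (Fin p) 𝕜} (hn : 1 ≤ n) (hp : 1 ≤ p) (hlam : 0 < lam) (ht : 0 ≤ t)
    (hpt : 2 ≤ p ∨ 1 ≤ t) (hy : ∀ k, Measurable (y k)) (hτ : ∀ k, Measurable (τ k))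
    (hτ' : ∀ k, Measurable (τ' k)) (hyL : ∀ k i, MemLp (fun ω => y k ω i) 2 μ)
    (hdith : ∀ k, IsDithered μ lam (y k) (τ k) (τ' k))
    (hind : iIndepFun (fun k ω => (y k ω, (τ k ω, τ' k ω))) μ)
    (hζ : ∀ k, ∫ ω, ∑ i, ‖(y k ω - clip lam ∘ y k ω) i‖ ^ 2 ∂μ ≤ 6 * p * lam ^ 2 / n)
    (hS : S = (n : 𝕜)⁻¹ • ∑ k, secondMoment μ (y k)) :
    1 - Real.exp (-t) ≤ μ.real {ω | estError lam y τ τ' S ω ≤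
      64 * ((lam * √(Cop μ y) + lam ^ 2) * √(rate n p t) + lam ^ 2 * rate n p t)} := by
  have : NeZero p := ⟨Nat.one_le_iff_ne_zero.1 hp⟩
  subst hS
  have hn0 : (0 : ℝ) < n := Nat.cast_pos.2 hn
  have hp0 : (0 : ℝ) < p := Nat.cast_pos.2 hp
  have hlog := log_two_le_log_add (p := p) (Nat.one_le_cast.2 hp) ht
    (hpt.imp_left fun hp2 => by exact_mod_cast hp2)
  obtain ⟨l, hl⟩ : ∃ l, l = Real.log p + t := ⟨_, rfl⟩
  rw [← hl] at hlog
  have hrate : rate n p t = p * l / n := by rw [rate, hl]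
  have hl2 : 1 / 2 ≤ l := by linarith [Real.log_two_gt_d9]
  have hL : 0 ≤ Real.log 2 + l := by linarith [Real.log_two_gt_d9]
  have hdev : p * (Real.log 2 + l) / n ≤ 2 * rate n p t := by
    rw [hrate, ← mul_div_assoc]
    gcongr ?_ / _
    nlinarith
  have htrunc : 6 * p * lam ^ 2 / n ≤ 12 * lam ^ 2 * rate n p t := by
    rw [hrate, ← mul_div_assoc]
    gcongr ?_ / _
    nlinarith [mul_le_mul_of_nonneg_left hl2 (by positivity : 0 ≤ p * lam ^ 2)]
  have hprob := measureReal_le_norm_sum_sampleMatrix_sub_le hlam hL hy hτ hτ' hyL hdith hind hζ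
    (opNorm_secondMoment_le_Cop y)
  refine one_sub_le_measureReal_of_compl_subset (hprob.trans_eq ?_) fun ω hω => ?_
  · rw [hl, ← add_assoc, ← Real.log_mul two_ne_zero hp0.ne', neg_add, Real.exp_add,
      Real.exp_neg (Real.log _), Real.exp_log (by positivity)]
    field_simp
  · rw [Set.mem_compl_iff, Set.mem_ofPred_eq, not_le] at hω
    have herr := opNorm_estimator_sub_le hn lam (fun k => y k ω) (fun k => τ k ω)
      (fun k => τ' k ω) _ _ fun k => opNorm_secondMoment_clip_sub_le hlam.le (hy k) (hyL k) (hζ k)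
        (opNorm_secondMoment_le_Cop y k)
    have hbound := deviation_add_bias_le hlam.le (Cop_nonneg (μ := μ) y) (by positivity)
      (rate_nonneg hp ht) htrunc hdev
    rw [Set.mem_ofPred_eq, ← div_le_div_iff_of_pos_right hn0]
    refine le_trans (le_of_eq ?_) (le_of_add_le_add_right
      (hbound.trans (hω.le.trans herr)))
    have hvar : n * (4 * p * lam ^ 2 * (Cop μ y + 6 * p * lam ^ 2 / n + lam ^ 2)) *
        (Real.log 2 + l) = n ^ 2 * (4 * lam ^ 2 * (Cop μ y + 6 * p * lam ^ 2 / n + lam ^ 2) *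
          (p * (Real.log 2 + l) / n)) := by
      field_simp
    rw [hvar, Real.sqrt_mul (sq_nonneg _), Real.sqrt_sq hn0.le]
    field_simp

end Concentration

section GaussianTails

variable {Ω : Type*} [MeasurableSpace Ω] {μ : Measure Ω} {lam s : ℝ}

theorem sub_clipReal_sq_le (hlam : 0 ≤ lam) (hs : 0 < s) (a : ℝ) :
    (a - clipReal lam a) ^ 2 ≤
      s ^ 2 * Real.exp (-(lam ^ 2 / s ^ 2)) * Real.exp (a ^ 2 / s ^ 2) := by
  rcases le_or_gt |a| lam with ha | ha
  · rw [clipReal_eq_self ha, sub_self, zero_pow two_ne_zero]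
    positivity
  have hdiff : (a - clipReal lam a) ^ 2 ≤ a ^ 2 - lam ^ 2 := by
    unfold clipReal
    rcases lt_abs.1 ha with h | h
    · rw [min_eq_right h.le, max_eq_right (by linarith)]
      nlinarith
    · rw [min_eq_left (by linarith), max_eq_left (by linarith)]
      nlinarith
  calc (a - clipReal lam a) ^ 2 ≤ s ^ 2 * (-(lam ^ 2 / s ^ 2) + a ^ 2 / s ^ 2) := by
        refine hdiff.trans_eq ?_
        field_simp
        ring
    _ ≤ s ^ 2 * Real.exp (-(lam ^ 2 / s ^ 2) + a ^ 2 / s ^ 2) := by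
        gcongr
        linarith [Real.add_one_le_exp (-(lam ^ 2 / s ^ 2) + a ^ 2 / s ^ 2)]
    _ = s ^ 2 * Real.exp (-(lam ^ 2 / s ^ 2)) * Real.exp (a ^ 2 / s ^ 2) := by
        rw [Real.exp_add, mul_assoc]

theorem integral_sub_clipReal_sq_le (hlam : 0 ≤ lam) (hs : 0 < s) {f : Ω → ℝ}
    (hf : AEMeasurable f μ)
    (htail : ∫⁻ ω, ENNReal.ofReal (Real.exp (f ω ^ 2 / s ^ 2)) ∂μ ≤ 3) :
    ∫ ω, (f ω - clipReal lam (f ω)) ^ 2 ∂μ ≤ s ^ 2 * Real.exp (-(lam ^ 2 / s ^ 2)) * 3 := by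
  have hmeas : AEMeasurable (fun ω => (f ω - clipReal lam (f ω)) ^ 2) μ :=
    (hf.sub (measurable_clipReal.comp_aemeasurable hf)).pow_const 2
  rw [integral_eq_lintegral_of_nonneg_ae (.of_forall fun ω => sq_nonneg _)
    hmeas.aestronglyMeasurable]
  refine ENNReal.toReal_le_of_le_ofReal (by positivity) ?_
  calc ∫⁻ ω, ENNReal.ofReal ((f ω - clipReal lam (f ω)) ^ 2) ∂μ
      ≤ ∫⁻ ω, ENNReal.ofReal (s ^ 2 * Real.exp (-(lam ^ 2 / s ^ 2))) *
          ENNReal.ofReal (Real.exp (f ω ^ 2 / s ^ 2)) ∂μ := by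
        refine lintegral_mono fun ω => ?_
        rw [← ENNReal.ofReal_mul (by positivity)]
        exact ENNReal.ofReal_le_ofReal (sub_clipReal_sq_le hlam hs _)
    _ ≤ ENNReal.ofReal (s ^ 2 * Real.exp (-(lam ^ 2 / s ^ 2))) * 3 := by
        rw [lintegral_const_mul' _ _ ENNReal.ofReal_ne_top]
        gcongr
    _ = ENNReal.ofReal (s ^ 2 * Real.exp (-(lam ^ 2 / s ^ 2)) * 3) := by
        rw [ENNReal.ofReal_mul' zero_le_three, ENNReal.ofReal_ofNat]

theorem half_le_log {n : ℕ} (hn : 2 ≤ n) : 1 / 2 ≤ Real.log n := by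
  linarith [Real.log_two_gt_d9, Real.log_le_log two_pos (Nat.ofNat_le_cast.2 hn : (2 : ℝ) ≤ n)]

-- At the scale `s ^ 2 = lam ^ 2 / (2 log n)` the factor `exp (-lam ^ 2 / s ^ 2)` is `n⁻²`.
theorem integral_sub_clipReal_sq_le_div (hlam : 0 < lam) {n : ℕ} (hn : 2 ≤ n) {f : Ω → ℝ}
    (hf : AEMeasurable f μ) (hs : 0 < s) (hs2 : s ^ 2 = lam ^ 2 / (2 * Real.log n))
    (htail : ∫⁻ ω, ENNReal.ofReal (Real.exp (f ω ^ 2 / s ^ 2)) ∂μ ≤ 3) :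
    ∫ ω, (f ω - clipReal lam (f ω)) ^ 2 ∂μ ≤ 3 * lam ^ 2 / n := by
  have hlog := half_le_log hn
  have hn1 : (1 : ℝ) ≤ n := Nat.one_le_cast.2 (by lia)
  have hexp : Real.exp (-(lam ^ 2 / s ^ 2)) = ((n : ℝ) ^ 2)⁻¹ := by
    have hratio : lam ^ 2 / s ^ 2 = 2 * Real.log n := by
      rw [hs2]
      field_simp
    rw [hratio, Real.exp_neg, ← Nat.cast_ofNat, ← Real.log_pow, Real.exp_log (by positivity)]
  calc ∫ ω, (f ω - clipReal lam (f ω)) ^ 2 ∂μ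
      ≤ lam ^ 2 / (2 * Real.log n) * ((n : ℝ) ^ 2)⁻¹ * 3 := by
        rw [← hs2, ← hexp]
        exact integral_sub_clipReal_sq_le hlam.le hs hf htail
    _ = 3 * lam ^ 2 / (2 * Real.log n * n ^ 2) := by field_simp
    _ ≤ 3 * lam ^ 2 / n := by
        gcongr
        nlinarith

theorem exp_add_sq_div_le (a b s : ℝ) : Real.exp ((a + b) ^ 2 / (2 * s) ^ 2) ≤
    1 / 2 * Real.exp (a ^ 2 / s ^ 2) + 1 / 2 * Real.exp (b ^ 2 / s ^ 2) := by
  have hexponent : (a + b) ^ 2 / (2 * s) ^ 2 ≤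
      1 / 2 * (a ^ 2 / s ^ 2) + 1 / 2 * (b ^ 2 / s ^ 2) := by
    calc (a + b) ^ 2 / (2 * s) ^ 2 = (a + b) ^ 2 / 4 / s ^ 2 := by
          rw [mul_pow, div_div]
          norm_num
      _ ≤ (a ^ 2 + b ^ 2) / 2 / s ^ 2 := by
          gcongr ?_ / _
          nlinarith [sq_nonneg (a - b)]
      _ = 1 / 2 * (a ^ 2 / s ^ 2) + 1 / 2 * (b ^ 2 / s ^ 2) := by ring
  exact (Real.exp_le_exp.2 hexponent).trans (convexOn_exp.2 (Set.mem_univ _) (Set.mem_univ _)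
    one_half_pos.le one_half_pos.le (add_halves 1))

theorem lintegral_exp_add_sq_le {f g : Ω → ℝ} (hf : AEMeasurable f μ)
    (hf3 : ∫⁻ ω, ENNReal.ofReal (Real.exp (f ω ^ 2 / s ^ 2)) ∂μ ≤ 3)
    (hg3 : ∫⁻ ω, ENNReal.ofReal (Real.exp (g ω ^ 2 / s ^ 2)) ∂μ ≤ 3) :
    ∫⁻ ω, ENNReal.ofReal (Real.exp ((f ω + g ω) ^ 2 / (2 * s) ^ 2)) ∂μ ≤ 3 := by
  have hhalf : ∀ a, ENNReal.ofReal (1 / 2 * Real.exp a) = 2⁻¹ * ENNReal.ofReal (Real.exp a) := by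
    intro a
    rw [ENNReal.ofReal_mul one_half_pos.le, one_div, ENNReal.ofReal_inv_of_pos two_pos,
      ENNReal.ofReal_ofNat]
  calc ∫⁻ ω, ENNReal.ofReal (Real.exp ((f ω + g ω) ^ 2 / (2 * s) ^ 2)) ∂μ
      ≤ ∫⁻ ω, (2⁻¹ * ENNReal.ofReal (Real.exp (f ω ^ 2 / s ^ 2)) +
          2⁻¹ * ENNReal.ofReal (Real.exp (g ω ^ 2 / s ^ 2))) ∂μ := by
        refine lintegral_mono fun ω => ?_
        rw [← hhalf, ← hhalf, ← ENNReal.ofReal_add (by positivity) (by positivity)]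
        exact ENNReal.ofReal_le_ofReal (exp_add_sq_div_le _ _ _)
    _ ≤ 2⁻¹ * 3 + 2⁻¹ * 3 := by
        rw [lintegral_add_left' (by fun_prop), lintegral_const_mul' _ _ (by simp),
          lintegral_const_mul' _ _ (by simp)]
        gcongr
    _ = 3 := by rw [← add_mul, ENNReal.inv_two_add_inv_two, one_mul]

variable {𝕜 : Type*} [RCLike 𝕜] {n p : ℕ} {κ : ℝ} {x e y : Ω → Fin p → 𝕜}

/-- The entries of the random vector `y` have Gaussian tails on the scale of their second
moments: `E exp (|re y_i| ^ 2 / s ^ 2) ≤ 3` as soon as `κ * E |y_i| ^ 2 ≤ s ^ 2`, and likewise for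
`im y_i`. Unlike subgaussianity, this allows nonzero means; the bound `3` exceeds `e`, so that
constant vectors qualify. -/
structure HasGaussianTails (μ : Measure Ω) (κ : ℝ) (y : Ω → Fin p → 𝕜) : Prop where
  re_tail : ∀ i (s : ℝ), 0 < s → κ * ∫ ω, ‖y ω i‖ ^ 2 ∂μ ≤ s ^ 2 →
    ∫⁻ ω, ENNReal.ofReal (Real.exp (RCLike.re (y ω i) ^ 2 / s ^ 2)) ∂μ ≤ 3
  im_tail : ∀ i (s : ℝ), 0 < s → κ * ∫ ω, ‖y ω i‖ ^ 2 ∂μ ≤ s ^ 2 →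
    ∫⁻ ω, ENNReal.ofReal (Real.exp (RCLike.im (y ω i) ^ 2 / s ^ 2)) ∂μ ≤ 3

theorem HasGaussianTails.add (hx : HasGaussianTails μ κ x) (he : HasGaussianTails μ κ e)
    (hκ : 0 ≤ κ) (hxm : Measurable x)
    (hx_le : ∀ i, ∫ ω, ‖x ω i‖ ^ 2 ∂μ ≤ ∫ ω, ‖(x ω + e ω) i‖ ^ 2 ∂μ)
    (he_le : ∀ i, ∫ ω, ‖e ω i‖ ^ 2 ∂μ ≤ ∫ ω, ‖(x ω + e ω) i‖ ^ 2 ∂μ) :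
    HasGaussianTails μ (4 * κ) fun ω => x ω + e ω := by
  have hscale : ∀ {c d s : ℝ}, c ≤ d → 4 * κ * d ≤ s ^ 2 → κ * c ≤ (s / 2) ^ 2 := fun hcd h => by
    nlinarith [mul_le_mul_of_nonneg_left hcd hκ]
  have hxi : ∀ i, Measurable fun ω => x ω i := fun i => measurable_pi_iff.1 hxm i
  refine ⟨fun i s hs h => ?_, fun i s hs h => ?_⟩
  · simpa only [Pi.add_apply, map_add, mul_div_cancel₀ s two_ne_zero] using
      lintegral_exp_add_sq_le (f := fun ω => RCLike.re (x ω i))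
        (RCLike.measurable_re.comp (hxi i)).aemeasurable
        (hx.re_tail i _ (half_pos hs) (hscale (hx_le i) h))
        (he.re_tail i _ (half_pos hs) (hscale (he_le i) h))
  · simpa only [Pi.add_apply, map_add, mul_div_cancel₀ s two_ne_zero] using
      lintegral_exp_add_sq_le (f := fun ω => RCLike.im (x ω i))
        (RCLike.measurable_im.comp (hxi i)).aemeasurable
        (hx.im_tail i _ (half_pos hs) (hscale (hx_le i) h))
        (he.im_tail i _ (half_pos hs) (hscale (he_le i) h))

theorem memLp_sub_clipReal [IsFiniteMeasure μ] (hlam : 0 ≤ lam) {f : Ω → ℝ} (hf : MemLp f 2 μ) :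
    MemLp (fun ω => f ω - clipReal lam (f ω)) 2 μ :=
  hf.sub (.of_bound (measurable_clipReal.comp_aemeasurable
    hf.aestronglyMeasurable.aemeasurable).aestronglyMeasurable lam
      (.of_forall fun _ => abs_clipReal_le hlam _))

theorem integral_norm_sub_clip_sq_le [IsFiniteMeasure μ] (hlam : 0 ≤ lam) {f : Ω → 𝕜}
    (hf : MemLp f 2 μ) : ∫ ω, ‖f ω - clip lam (f ω)‖ ^ 2 ∂μ ≤
      ∫ ω, (RCLike.re (f ω) - clipReal lam (RCLike.re (f ω))) ^ 2 ∂μ +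
      ∫ ω, (RCLike.im (f ω) - clipReal lam (RCLike.im (f ω))) ^ 2 ∂μ := by
  have hre := (memLp_sub_clipReal hlam hf.re).integrable_sq
  have him := (memLp_sub_clipReal hlam hf.im).integrable_sq
  rw [← integral_add hre him]
  exact integral_mono_of_nonneg (.of_forall fun ω => sq_nonneg _) (hre.add him)
    (.of_forall fun ω => norm_sub_clip_sq_le _)

theorem HasGaussianTails.integral_norm_sub_clip_sq_le [IsFiniteMeasure μ]
    (h : HasGaussianTails μ κ y) (hlam : 0 < lam) (hn : 2 ≤ n) (hy : Measurable y)
    (hyL : ∀ i, MemLp (fun ω => y ω i) 2 μ)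
    (hκ : ∀ i, 2 * κ * Real.log n * ∫ ω, ‖y ω i‖ ^ 2 ∂μ ≤ lam ^ 2) :
    ∫ ω, ∑ i, ‖(y ω - clip lam ∘ y ω) i‖ ^ 2 ∂μ ≤ 6 * p * lam ^ 2 / n := by
  have hlog : 0 < Real.log n := one_half_pos.trans_le (half_le_log hn)
  set s := √(lam ^ 2 / (2 * Real.log n))
  have hs2 : s ^ 2 = lam ^ 2 / (2 * Real.log n) := Real.sq_sqrt (by positivity)
  have hs : 0 < s := Real.sqrt_pos.2 (by positivity)
  have hscale : ∀ i, κ * ∫ ω, ‖y ω i‖ ^ 2 ∂μ ≤ s ^ 2 := fun i => by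
    rw [hs2, le_div_iff₀ (by positivity)]
    linarith [hκ i]
  have hentry : ∀ i, ∫ ω, ‖(y ω - clip lam ∘ y ω) i‖ ^ 2 ∂μ ≤ 6 * lam ^ 2 / n := fun i => by
    have hre := integral_sub_clipReal_sq_le_div hlam hn (hyL i).re.aestronglyMeasurable.aemeasurable
      hs hs2 (h.re_tail i s hs (hscale i))
    have him := integral_sub_clipReal_sq_le_div hlam hn (hyL i).im.aestronglyMeasurable.aemeasurable
      hs hs2 (h.im_tail i s hs (hscale i))
    exact (OneBitCov.integral_norm_sub_clip_sq_le hlam.le (hyL i)).trans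
      ((add_le_add hre him).trans_eq (by ring))
  have hint : ∀ i, Integrable (fun ω => ‖(y ω - clip lam ∘ y ω) i‖ ^ 2) μ := fun i =>
    ((hyL i).sub (memLp_clip hlam.le hy i)).norm.integrable_sq
  rw [integral_finsetSum _ fun i _ => hint i]
  refine (Finset.sum_le_card_nsmul _ _ _ fun i _ => hentry i).trans_eq ?_
  rw [Finset.card_univ, Fintype.card_fin, nsmul_eq_mul]
  ring

theorem integral_norm_sub_clip_sq_eq_zero (h : ∀ᵐ ω ∂μ, ∀ i, ‖y ω i‖ ≤ lam) :
    ∫ ω, ∑ i, ‖(y ω - clip lam ∘ y ω) i‖ ^ 2 ∂μ = 0 := by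
  refine integral_eq_zero_of_ae ?_
  filter_upwards [h] with ω hω
  exact Finset.sum_eq_zero fun i _ => by
    rw [Pi.sub_apply, Function.comp_apply, clip_eq_self (hω i), sub_self, norm_zero,
      zero_pow two_ne_zero]

end GaussianTails

section Maxima

open scoped Matrix.Norms.L2Operator

variable {𝕜 : Type*} [RCLike 𝕜] {Ω : Type*} [MeasurableSpace Ω] {μ : Measure Ω} {n p : ℕ}

theorem norm_apply_le_maxNorm (A : Matrix (Fin p) (Fin p) 𝕜) (i j : Fin p) :
    ‖A i j‖ ≤ maxNorm A :=
  (le_ciSup (f := fun j => ‖A i j‖) (Set.finite_range _).bddAbove j).trans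
    (le_ciSup (f := fun i => ⨆ j, ‖A i j‖) (Set.finite_range _).bddAbove i)

theorem norm_apply_le_l2_opNorm {l m : Type*} [Fintype l] [Fintype m] [DecidableEq m]
    (A : Matrix l m 𝕜) (i : l) (j : m) : ‖A i j‖ ≤ ‖A‖ := by
  have hcol := Matrix.l2_opNorm_mulVec A (EuclideanSpace.single j (1 : 𝕜))
  rw [PiLp.norm_single, norm_one, mul_one] at hcol
  simpa using (PiLp.norm_apply_le _ i).trans hcol

theorem maxNorm_le_opNorm [Nonempty (Fin p)] (A : Matrix (Fin p) (Fin p) 𝕜) :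
    maxNorm A ≤ opNorm A :=
  ciSup_le fun i => ciSup_le fun j => norm_apply_le_l2_opNorm A i j

theorem maxNorm_secondMoment_le_Cinf (y : Fin n → Ω → Fin p → 𝕜) (k : Fin n) :
    maxNorm (secondMoment μ (y k)) ≤ Cinf μ y :=
  le_ciSup (f := fun k => maxNorm (secondMoment μ (y k))) (Set.finite_range _).bddAbove k

theorem Cinf_le_Cop [Nonempty (Fin n)] [Nonempty (Fin p)] (y : Fin n → Ω → Fin p → 𝕜) :
    Cinf μ y ≤ Cop μ y :=
  ciSup_le fun k => (maxNorm_le_opNorm _).trans (opNorm_secondMoment_le_Cop y k)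

theorem Cinf_nonneg (y : Fin n → Ω → Fin p → 𝕜) : 0 ≤ Cinf μ y :=
  Real.iSup_nonneg fun _ => Real.iSup_nonneg fun _ => Real.iSup_nonneg fun _ => norm_nonneg _

theorem secondMoment_apply_self (y : Ω → Fin p → 𝕜) (i : Fin p) :
    secondMoment μ y i i = ((∫ ω, ‖y ω i‖ ^ 2 ∂μ : ℝ) : 𝕜) := by
  simp only [secondMoment, Matrix.of_apply, outer, Matrix.vecMulVec_apply, Pi.star_apply,
    RCLike.star_def, RCLike.mul_conj, ← integral_ofReal, RCLike.ofReal_pow]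

theorem integral_norm_sq_le_Cinf (y : Fin n → Ω → Fin p → 𝕜) (k : Fin n) (i : Fin p) :
    ∫ ω, ‖y k ω i‖ ^ 2 ∂μ ≤ Cinf μ y := by
  refine le_trans ?_ ((norm_apply_le_maxNorm _ i i).trans (maxNorm_secondMoment_le_Cinf y k))
  rw [secondMoment_apply_self, RCLike.norm_ofReal]
  exact le_abs_self _

theorem bound_le_of_sq_le {l D C r b lam : ℝ} (hl : 1 / 2 ≤ l) (hD : 0 ≤ D) (hDC : D ≤ C)
    (hr : 0 ≤ r) (hb : 0 < b) (h : lam ^ 2 ≤ b * l * D) :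
    (lam * √C + lam ^ 2) * √r + lam ^ 2 * r ≤
      (2 * √b + b) * (l * √(C * D * r) + l * D * r) := by
  have hC : 0 ≤ C := hD.trans hDC
  have hl0 : 0 ≤ l := by linarith
  have hsqrt_l : √l ≤ 2 * l := by
    rw [Real.sqrt_le_left (by linarith)]
    nlinarith
  have hlam : lam ≤ √b * √l * √D := by
    rw [← Real.sqrt_mul hb.le, ← Real.sqrt_mul (by positivity)]
    exact Real.le_sqrt_of_sq_le h
  have hlamC : lam * √C ≤ 2 * √b * l * √(C * D) := by
    calc lam * √C ≤ √b * √l * √D * √C := by gcongr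
      _ ≤ √b * (2 * l) * √D * √C := by gcongr
      _ = 2 * √b * l * √(C * D) := by
        rw [Real.sqrt_mul hC]
        ring
  have hDsqrt : D ≤ √(C * D) := Real.le_sqrt_of_sq_le (by nlinarith)
  have hlam2 : lam ^ 2 ≤ b * l * √(C * D) := h.trans (by gcongr)
  have hcross : 0 ≤ √b * (l * D * r) := by positivity
  calc (lam * √C + lam ^ 2) * √r + lam ^ 2 * r
      ≤ (2 * √b * l * √(C * D) + b * l * √(C * D)) * √r + b * l * D * r := by gcongr
    _ ≤ (2 * √b + b) * (l * (√(C * D) * √r) + l * D * r) := by linarith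
    _ = (2 * √b + b) * (l * √(C * D * r) + l * D * r) := by rw [← Real.sqrt_mul (by positivity)]

end Maxima

section Independence

variable {Ω : Type*} [MeasurableSpace Ω] {μ : Measure Ω}

theorem iIndepFun_curry {ι : Type*} {κ : ι → Type*} {𝓧 : (i : ι) → κ i → Type*}
    [∀ i j, MeasurableSpace (𝓧 i j)] [Countable ι] [∀ i, Countable (κ i)]
    {X : (q : (i : ι) × κ i) → Ω → 𝓧 q.1 q.2} (hX : ∀ q, AEMeasurable (X q) μ)
    (h : iIndepFun X μ) : iIndepFun (fun i ω j => X ⟨i, j⟩ ω) μ := by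
  have := h.isProbabilityMeasure
  have : ∀ i j, IsProbabilityMeasure (μ.map (X ⟨i, j⟩)) := fun i j =>
    Measure.isProbabilityMeasure_map (hX ⟨i, j⟩)
  have hcurry : (fun ω i j => X ⟨i, j⟩ ω) = MeasurableEquiv.piCurry 𝓧 ∘ fun ω q => X q ω := by
    ext
    simp [Sigma.curry]
  have hrow : ∀ i, μ.map (fun ω j => X ⟨i, j⟩ ω) =
      Measure.infinitePi fun j => μ.map (X ⟨i, j⟩) := fun i =>
    (h.precomp (sigma_mk_injective (i := i))).map_fun_eq_infinitePi_map₀' fun j => hX ⟨i, j⟩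
  rw [iIndepFun_iff_map_fun_eq_infinitePi_map₀' fun i => aemeasurable_pi_iff.2 fun j => hX ⟨i, j⟩,
    hcurry, ← AEMeasurable.map_map_of_aemeasurable
      (MeasurableEquiv.measurable _).aemeasurable (aemeasurable_pi_iff.2 hX),
    h.map_fun_eq_infinitePi_map₀' hX]
  simp only [hrow]
  exact Measure.infinitePi_map_piCurry fun i j => μ.map (X ⟨i, j⟩)

theorem iIndepFun_add_prodMk {κ β : Type*} [Countable κ] [MeasurableSpace β] [Add β]
    [MeasurableAdd₂ β] {x e τ τ' : κ → Ω → β} (hx : ∀ k, AEMeasurable (x k) μ)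
    (he : ∀ k, AEMeasurable (e k) μ) (hτ : ∀ k, AEMeasurable (τ k) μ)
    (hτ' : ∀ k, AEMeasurable (τ' k) μ)
    (h : iIndepFun (Sum.elim (Sum.elim x e) (Sum.elim τ τ')) μ) :
    iIndepFun (fun k ω => (x k ω + e k ω, (τ k ω, τ' k ω))) μ := by
  let g : (_ : κ) × Fin 4 → (κ ⊕ κ) ⊕ (κ ⊕ κ) := fun q =>
    ![.inl (.inl q.1), .inl (.inr q.1), .inr (.inl q.1), .inr (.inr q.1)] q.2
  have hg : g.Injective := by
    rintro ⟨k, c⟩ ⟨l, d⟩ hkl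
    fin_cases c <;> fin_cases d <;> simp_all [g]
  have hm : ∀ i, AEMeasurable (Sum.elim (Sum.elim x e) (Sum.elim τ τ') i) μ := by
    rintro ((k | k) | (k | k))
    exacts [hx k, he k, hτ k, hτ' k]
  have hpack : Measurable fun w : Fin 4 → β => (w 0 + w 1, (w 2, w 3)) := by fun_prop
  have hgroup : iIndepFun (fun k ω => ![x k ω, e k ω, τ k ω, τ' k ω]) μ := by
    convert iIndepFun_curry (κ := fun _ => Fin 4) (𝓧 := fun _ _ => β) (fun q => hm (g q))
      (h.precomp hg) with k ω c
    fin_cases c <;> rfl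
  exact hgroup.comp _ fun _ => hpack

variable {𝕜 : Type*} [RCLike 𝕜] {p : ℕ} {lam : ℝ}

theorem isDithered_add_of_iIndepFun {κ : Type*} {x e τ τ' : κ → Ω → Fin p → 𝕜}
    (hx : ∀ k, AEMeasurable (x k) μ) (he : ∀ k, AEMeasurable (e k) μ)
    (hτ : ∀ k, HasLaw (τ k) (ditherVecLaw 𝕜 p lam) μ)
    (hτ' : ∀ k, HasLaw (τ' k) (ditherVecLaw 𝕜 p lam) μ)
    (h : iIndepFun (Sum.elim (Sum.elim x e) (Sum.elim τ τ')) μ) (k : κ) :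
    IsDithered μ lam (fun ω => x k ω + e k ω) (τ k) (τ' k) := by
  have := h.isProbabilityMeasure
  have hm : ∀ i, AEMeasurable (Sum.elim (Sum.elim x e) (Sum.elim τ τ') i) μ := by
    rintro ((k | k) | (k | k))
    exacts [hx k, he k, (hτ k).aemeasurable, (hτ' k).aemeasurable]
  have hpair : IndepFun (fun ω => (x k ω, e k ω)) (fun ω => (τ k ω, τ' k ω)) μ :=
    h.indepFun_prodMk_prodMk₀ hm (.inl (.inl k)) (.inl (.inr k)) (.inr (.inl k)) (.inr (.inr k))
      (by simp) (by simp) (by simp) (by simp)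
  have hsum : IndepFun (fun ω => x k ω + e k ω) (fun ω => (τ k ω, τ' k ω)) μ :=
    hpair.comp (measurable_fst.add measurable_snd) measurable_id
  have hdith : IndepFun (τ k) (τ' k) μ :=
    h.indepFun (i := .inr (.inl k)) (j := .inr (.inr k)) (by simp)
  have hy : AEMeasurable (fun ω => x k ω + e k ω) μ := (hx k).add (he k)
  rw [IsDithered, hsum.map_prod_eq_prod_map_map hy
      ((hτ k).aemeasurable.prodMk (hτ' k).aemeasurable),
    hdith.map_prod_eq_prod_map_map (hτ k).aemeasurable (hτ' k).aemeasurable, (hτ k).map_eq,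
    (hτ' k).map_eq]

theorem IsDithered.aemeasurable [IsProbabilityMeasure μ] {y τ τ' : Ω → Fin p → 𝕜}
    (h : IsDithered μ lam y τ τ') (hlam : 0 < lam) (hy : AEMeasurable y μ) :
    AEMeasurable (fun ω => (τ ω, τ' ω)) μ := by
  have := isProbabilityMeasure_ditherVecLaw (𝕜 := 𝕜) hlam p
  have := Measure.isProbabilityMeasure_map hy
  have htriple : AEMeasurable (fun ω => (y ω, (τ ω, τ' ω))) μ :=
    .of_map_ne_zero (h ▸ IsProbabilityMeasure.ne_zero _)
  exact htriple.snd

theorem IsDithered.congr {y τ τ' σ σ' : Ω → Fin p → 𝕜} (h : IsDithered μ lam y τ τ')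
    (hτ : τ =ᵐ[μ] σ) (hτ' : τ' =ᵐ[μ] σ') : IsDithered μ lam y σ σ' := by
  rw [IsDithered, ← h]
  refine Measure.map_congr ?_
  filter_upwards [hτ, hτ'] with ω hω hω'
  rw [hω, hω']

theorem estError_le_of_truncation [IsProbabilityMeasure μ] {n : ℕ} {t : ℝ}
    {y τ τ' : Fin n → Ω → Fin p → 𝕜} {S : Matrix (Fin p) (Fin p) 𝕜} (hn : 1 ≤ n) (hp : 1 ≤ p)
    (hlam : 0 < lam) (ht : 0 ≤ t) (hpt : 2 ≤ p ∨ 1 ≤ t) (hy : ∀ k, Measurable (y k))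
    (hyL : ∀ k i, MemLp (fun ω => y k ω i) 2 μ)
    (hdith : ∀ k, IsDithered μ lam (y k) (τ k) (τ' k))
    (hind : iIndepFun (fun k ω => (y k ω, (τ k ω, τ' k ω))) μ)
    (hS : S = (n : 𝕜)⁻¹ • ∑ k, secondMoment μ (y k))
    (hζ : ∀ k, ∫ ω, ∑ i, ‖(y k ω - clip lam ∘ y k ω) i‖ ^ 2 ∂μ ≤ 6 * p * lam ^ 2 / n) :
    1 - Real.exp (-t) ≤ μ.real {ω | estError lam y τ τ' S ω ≤
      64 * ((lam * √(Cop μ y) + lam ^ 2) * √(rate n p t) + lam ^ 2 * rate n p t)} := by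
  have hττ' := fun k => (hdith k).aemeasurable hlam (hy k).aemeasurable
  choose σ hσ hτσ using fun k => (hττ' k).fst
  choose σ' hσ' hτσ' using fun k => (hττ' k).snd
  have hindσ : iIndepFun (fun k ω => (y k ω, (σ k ω, σ' k ω))) μ := hind.congr fun k => by
    filter_upwards [hτσ k, hτσ' k] with ω hω hω'
    rw [hω, hω']
  refine (estError_le_of_truncation_of_measurable hn hp hlam ht hpt hy hσ hσ' hyL
    (fun k => (hdith k).congr (hτσ k) (hτσ' k)) hindσ hζ hS).trans_eq
      (measureReal_congr (Filter.eventuallyEq_set.2 ?_))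
  filter_upwards [ae_all_iff.2 hτσ, ae_all_iff.2 hτσ'] with ω hω hω'
  simp only [estError, hω, hω']

end Independence

section Subgaussian

variable {Ω : Type*} [MeasurableSpace Ω] {μ : Measure Ω} {p : ℕ} {K κ : ℝ}

theorem lintegral_exp_le_two_of_psi2Norm_lt {X : Ω → ℝ} {s : ℝ}
    (h : psi2Norm μ X < ENNReal.ofReal s) :
    ∫⁻ ω, ENNReal.ofReal (Real.exp (X ω ^ 2 / s ^ 2)) ∂μ ≤ 2 := by
  obtain ⟨_, ⟨t, ht, rfl, hle⟩, hlt⟩ := sInf_lt_iff.1 h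
  have hts : t < s := (ENNReal.ofReal_lt_ofReal_iff_of_nonneg ht.le).1 hlt
  refine (lintegral_mono fun ω => ENNReal.ofReal_le_ofReal (Real.exp_le_exp.2 ?_)).trans hle
  rw [sq_abs]
  gcongr

theorem IsSubgaussianReal.lintegral_exp_le_two {y : Ω → Fin p → ℝ}
    (h : IsSubgaussianReal μ K y) (i : Fin p) {s : ℝ} (hs : 0 < s)
    (hlt : K ^ 2 * ∫ ω, y ω i ^ 2 ∂μ < s ^ 2) :
    ∫⁻ ω, ENNReal.ofReal (Real.exp (y ω i ^ 2 / s ^ 2)) ∂μ ≤ 2 := by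
  refine lintegral_exp_le_two_of_psi2Norm_lt ?_
  have hcoord : (fun ω => ∑ j, y ω j * (Pi.single i 1 : Fin p → ℝ) j) = fun ω => y ω i := by
    ext ω
    simp [Pi.single_apply]
  have hpsi := h.psi2_le (Pi.single i 1)
  have hnorm : eLpNorm (fun ω => y ω i) 2 μ = ENNReal.ofReal √(∫ ω, y ω i ^ 2 ∂μ) := by
    rw [(h.memLp i).eLpNorm_eq_integral_rpow_norm two_ne_zero ENNReal.ofNat_ne_top]
    simp only [ENNReal.toReal_ofNat, Real.rpow_two, Real.norm_eq_abs, sq_abs, ← one_div,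
      ← Real.sqrt_eq_rpow]
  rw [hcoord, hnorm] at hpsi
  calc psi2Norm μ (fun ω => y ω i)
      ≤ ENNReal.ofReal K * ENNReal.ofReal √(∫ ω, y ω i ^ 2 ∂μ) := hpsi
    _ ≤ ENNReal.ofReal (|K| * √(∫ ω, y ω i ^ 2 ∂μ)) := by
        rw [ENNReal.ofReal_mul (abs_nonneg K)]
        gcongr
        exact le_abs_self K
    _ < ENNReal.ofReal s := by
        refine (ENNReal.ofReal_lt_ofReal_iff hs).2 (lt_of_pow_lt_pow_left₀ 2 hs.le ?_)
        rwa [mul_pow, sq_abs, Real.sq_sqrt (integral_nonneg fun ω => sq_nonneg _)]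

variable {𝕜 : Type*} [RCLike 𝕜]

theorem re_sq_le_norm_sq (z : 𝕜) : RCLike.re z ^ 2 ≤ ‖z‖ ^ 2 :=
  sq_le_sq.2 ((RCLike.abs_re_le_norm z).trans (le_abs_self _))

theorem im_sq_le_norm_sq (z : 𝕜) : RCLike.im z ^ 2 ≤ ‖z‖ ^ 2 :=
  sq_le_sq.2 ((RCLike.abs_im_le_norm z).trans (le_abs_self _))

theorem hasGaussianTails_const [IsProbabilityMeasure μ] (hκ : 1 ≤ κ) (v : Fin p → 𝕜) :
    HasGaussianTails μ κ fun _ => v := by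
  have hexp : ∀ {a b s : ℝ}, 0 < s → a ^ 2 ≤ b ^ 2 → κ * ∫ _ω, b ^ 2 ∂μ ≤ s ^ 2 →
      ∫⁻ _ω, ENNReal.ofReal (Real.exp (a ^ 2 / s ^ 2)) ∂μ ≤ 3 := fun {a b s} hs hab h => by
    rw [integral_const, probReal_univ, one_smul] at h
    have hratio : a ^ 2 / s ^ 2 ≤ 1 := by
      rw [div_le_one (by positivity)]
      nlinarith [sq_nonneg b]
    rw [lintegral_const, measure_univ, mul_one, ← ENNReal.ofReal_ofNat]
    exact ENNReal.ofReal_le_ofReal ((Real.exp_le_exp.2 hratio).trans Real.exp_one_lt_three.le)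
  exact ⟨fun i s hs => hexp hs (re_sq_le_norm_sq (v i)),
    fun i s hs => hexp hs (im_sq_le_norm_sq (v i))⟩

theorem IsSubgaussian.memLp {x : Ω → Fin p → 𝕜} (h : IsSubgaussian μ K x) (i : Fin p) :
    MemLp (fun ω => x ω i) 2 μ :=
  memLp_re_im_iff.1 ⟨h.1.memLp i, h.2.memLp i⟩

theorem IsSubgaussian.hasGaussianTails {x : Ω → Fin p → 𝕜} (h : IsSubgaussian μ K x)
    (hκ : K ^ 2 < κ) : HasGaussianTails μ κ x := by
  have hscale : ∀ {i : Fin p} {f : Ω → ℝ} {s : ℝ}, (∀ ω, f ω ^ 2 ≤ ‖x ω i‖ ^ 2) → 0 < s →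
      κ * ∫ ω, ‖x ω i‖ ^ 2 ∂μ ≤ s ^ 2 → K ^ 2 * ∫ ω, f ω ^ 2 ∂μ < s ^ 2 :=
      fun {i f s} hf hs hκs => by
    have hfx : ∫ ω, f ω ^ 2 ∂μ ≤ ∫ ω, ‖x ω i‖ ^ 2 ∂μ :=
      integral_mono_of_nonneg (.of_forall fun ω => sq_nonneg _) (h.memLp i).norm.integrable_sq
        (.of_forall hf)
    have hx0 : 0 ≤ ∫ ω, ‖x ω i‖ ^ 2 ∂μ := integral_nonneg fun ω => sq_nonneg _
    refine (mul_le_mul_of_nonneg_left hfx (sq_nonneg K)).trans_lt ?_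
    rcases hx0.eq_or_lt with h0 | h0
    · rw [← h0, mul_zero]
      positivity
    · exact (mul_lt_mul_of_pos_right hκ h0).trans_le hκs
  exact ⟨fun i s hs hκs => (h.1.lintegral_exp_le_two i hs
      (hscale (fun ω => re_sq_le_norm_sq _) hs hκs)).trans (by norm_num),
    fun i s hs hκs => (h.2.lintegral_exp_le_two i hs
      (hscale (fun ω => im_sq_le_norm_sq _) hs hκs)).trans (by norm_num)⟩

end Subgaussian

section SecondMoment

variable {𝕜 : Type*} [RCLike 𝕜] {Ω : Type*} [MeasurableSpace Ω] {μ : Measure Ω} {p : ℕ}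

theorem integral_mul_star_of_indepFun {f g : Ω → 𝕜} (h : IndepFun f g μ)
    (hf : AEStronglyMeasurable f μ) (hg : AEStronglyMeasurable g μ) :
    ∫ ω, f ω * star (g ω) ∂μ = (∫ ω, f ω ∂μ) * star (∫ ω, g ω ∂μ) := by
  have hstar : IndepFun f (fun ω => star (g ω)) μ :=
    h.comp measurable_id continuous_star.measurable
  rw [hstar.integral_fun_mul_eq_mul_integral hf (continuous_star.comp_aestronglyMeasurable hg)]
  simp only [RCLike.star_def, integral_conj]

theorem secondMoment_add_of_indepFun {x e : Ω → Fin p → 𝕜}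
    (hx : ∀ i, MemLp (fun ω => x ω i) 2 μ) (he : ∀ i, MemLp (fun ω => e ω i) 2 μ)
    (hind : IndepFun x e μ) (hmean : ∀ i, ∫ ω, e ω i ∂μ = 0) :
    secondMoment μ (fun ω => x ω + e ω) = secondMoment μ x + secondMoment μ e := by
  ext i j
  have hxe : ∫ ω, x ω i * star (e ω j) ∂μ = 0 := by
    rw [integral_mul_star_of_indepFun (f := fun ω => x ω i) (g := fun ω => e ω j)
      (hind.comp (measurable_pi_apply i) (measurable_pi_apply j)) (hx i).aestronglyMeasurable
      (he j).aestronglyMeasurable, hmean, star_zero, mul_zero]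
  have hex : ∫ ω, e ω i * star (x ω j) ∂μ = 0 := by
    rw [integral_mul_star_of_indepFun (f := fun ω => e ω i) (g := fun ω => x ω j)
      (hind.symm.comp (measurable_pi_apply i) (measurable_pi_apply j))
      (he i).aestronglyMeasurable (hx j).aestronglyMeasurable, hmean, zero_mul]
  have hxx' : Integrable (fun ω => x ω i * star (x ω j)) μ := (hx i).integrable_mul (hx j).star
  have hxe' : Integrable (fun ω => x ω i * star (e ω j)) μ := (hx i).integrable_mul (he j).star
  have hex' : Integrable (fun ω => e ω i * star (x ω j)) μ := (he i).integrable_mul (hx j).star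
  have hee' : Integrable (fun ω => e ω i * star (e ω j)) μ := (he i).integrable_mul (he j).star
  have hx_star : Integrable (fun ω => x ω i * star (x ω j) + e ω i * star (x ω j)) μ :=
    hxx'.add hex'
  have he_star : Integrable (fun ω => x ω i * star (e ω j) + e ω i * star (e ω j)) μ :=
    hxe'.add hee'
  simp only [secondMoment, Matrix.of_apply, Matrix.add_apply, outer_apply, Pi.add_apply, star_add,
    mul_add, add_mul]
  rw [integral_add hx_star he_star, integral_add hxx' hex', integral_add hxe' hee', hxe, hex,
    add_zero, zero_add]

theorem secondMoment_const [IsProbabilityMeasure μ] (v : Fin p → 𝕜) :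
    secondMoment μ (fun _ => v) = outer v v := by
  ext i j
  simp only [secondMoment, Matrix.of_apply, integral_const, probReal_univ, one_smul]

end SecondMoment

section Model

variable {𝕜 : Type*} [RCLike 𝕜] {Ω : Type*} [MeasurableSpace Ω] {μ : Measure Ω} {n p : ℕ}
  {K ν : ℝ} {x e : Fin n → Ω → Fin p → 𝕜} {Sx Se : Matrix (Fin p) (Fin p) 𝕜}

theorem measurable_signal (hx : DeterministicSignal x Sx ∨ StochasticSignal μ K x Sx)
    (k : Fin n) : Measurable (x k) := by
  rcases hx with ⟨v, hv, -⟩ | hx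
  · rw [hv k]
    exact measurable_const
  · exact hx.measurable k

theorem memLp_signal [IsProbabilityMeasure μ]
    (hx : DeterministicSignal x Sx ∨ StochasticSignal μ K x Sx) (k : Fin n) (i : Fin p) :
    MemLp (fun ω => x k ω i) 2 μ := by
  rcases hx with ⟨v, hv, -⟩ | hx
  · rw [hv k]
    exact memLp_const _
  · exact (hx.subgaussian k).memLp i

theorem hasGaussianTails_signal [IsProbabilityMeasure μ]
    (hx : DeterministicSignal x Sx ∨ StochasticSignal μ K x Sx) (k : Fin n) :
    HasGaussianTails μ (K ^ 2 + 1) (x k) := by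
  rcases hx with ⟨v, hv, -⟩ | hx
  · rw [hv k]
    exact hasGaussianTails_const (by nlinarith) (v k)
  · exact (hx.subgaussian k).hasGaussianTails (lt_add_one _)

theorem inv_smul_sum_const (hn : n ≠ 0) (A : Matrix (Fin p) (Fin p) 𝕜) :
    (n : 𝕜)⁻¹ • ∑ _k : Fin n, A = A := by
  rw [Finset.sum_const, Finset.card_univ, Fintype.card_fin, ← Nat.cast_smul_eq_nsmul 𝕜,
    inv_smul_smul₀ (Nat.cast_ne_zero.2 hn)]

theorem signal_cov_eq [IsProbabilityMeasure μ] (hn : n ≠ 0)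
    (hx : DeterministicSignal x Sx ∨ StochasticSignal μ K x Sx) :
    Sx = (n : 𝕜)⁻¹ • ∑ k, secondMoment μ (x k) := by
  rcases hx with ⟨v, hv, h⟩ | hx
  · simp only [h, hv, secondMoment_const]
  · simp only [← hx.cov, inv_smul_sum_const hn]

theorem measurable_obs (hx : DeterministicSignal x Sx ∨ StochasticSignal μ K x Sx)
    (he : NoiseModel μ K ν e Se) (k : Fin n) : Measurable (obs x e k) :=
  (measurable_signal hx k).add (he.measurable k)

variable [IsProbabilityMeasure μ] (hx : DeterministicSignal x Sx ∨ StochasticSignal μ K x Sx)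
  (he : NoiseModel μ K ν e Se)
include hx he

theorem memLp_obs (k : Fin n) (i : Fin p) : MemLp (fun ω => obs x e k ω i) 2 μ :=
  (memLp_signal hx k i).add ((he.subgaussian k).memLp i)

theorem secondMoment_obs (hind : ∀ k, IndepFun (x k) (e k) μ) (k : Fin n) :
    secondMoment μ (obs x e k) = secondMoment μ (x k) + secondMoment μ (e k) :=
  secondMoment_add_of_indepFun (memLp_signal hx k) (he.subgaussian k).memLp (hind k)
    (he.mean_zero k)

theorem obs_cov_eq (hn : n ≠ 0) (hind : ∀ k, IndepFun (x k) (e k) μ) :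
    Sx + Se = (n : 𝕜)⁻¹ • ∑ k, secondMoment μ (obs x e k) := by
  simp only [secondMoment_obs hx he hind, ← he.cov, Finset.sum_add_distrib, smul_add,
    inv_smul_sum_const hn, ← signal_cov_eq hn hx]

theorem integral_norm_sq_obs (hind : ∀ k, IndepFun (x k) (e k) μ) (k : Fin n) (i : Fin p) :
    ∫ ω, ‖obs x e k ω i‖ ^ 2 ∂μ = ∫ ω, ‖x k ω i‖ ^ 2 ∂μ + ∫ ω, ‖e k ω i‖ ^ 2 ∂μ := by
  have hdiag := congrFun₂ (secondMoment_obs hx he hind k) i i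
  simp only [Matrix.add_apply, secondMoment_apply_self] at hdiag
  exact_mod_cast hdiag

theorem hasGaussianTails_obs (hind : ∀ k, IndepFun (x k) (e k) μ) (k : Fin n) :
    HasGaussianTails μ (4 * (K ^ 2 + 1)) (obs x e k) :=
  (hasGaussianTails_signal hx k).add ((he.subgaussian k).hasGaussianTails (lt_add_one _))
    (by positivity) (measurable_signal hx k)
    (fun i => (le_add_of_nonneg_right (integral_nonneg fun ω => sq_nonneg _)).trans_eq
      (integral_norm_sq_obs hx he hind k i).symm)
    (fun i => (le_add_of_nonneg_left (integral_nonneg fun ω => sq_nonneg _)).trans_eq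
      (integral_norm_sq_obs hx he hind k i).symm)

end Model

end OneBitCov

theorem theorem5_general {𝕜 : Type*} [RCLike 𝕜] {Ω : Type*} [MeasurableSpace Ω] {μ : Measure Ω}
    [IsProbabilityMeasure μ] {n p : ℕ} {y τ τ' : Fin n → Ω → Fin p → 𝕜} {κ lam t : ℝ}
    {S : Matrix (Fin p) (Fin p) 𝕜} (hn : 1 ≤ n) (hp : 1 ≤ p) (hκ : 0 ≤ κ) (hlam : 0 < lam)
    (ht : 0 ≤ t) (hpt : 2 ≤ p ∨ 1 ≤ t) (hy : ∀ k, Measurable (y k))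
    (hyL : ∀ k i, MemLp (fun ω => y k ω i) 2 μ)
    (hdith : ∀ k, OneBitCov.IsDithered μ lam (y k) (τ k) (τ' k))
    (hind : iIndepFun (fun k ω => (y k ω, (τ k ω, τ' k ω))) μ)
    (hS : S = (n : 𝕜)⁻¹ • ∑ k, OneBitCov.secondMoment μ (y k)) :
    ((∀ k, OneBitCov.HasGaussianTails μ κ (y k)) → 2 ≤ n →
      2 * κ * Real.log n * OneBitCov.Cinf μ y ≤ lam ^ 2 →
      1 - Real.exp (-t) ≤ μ.real {ω | OneBitCov.estError lam y τ τ' S ω ≤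
        64 * ((lam * √(OneBitCov.Cop μ y) + lam ^ 2) * √(OneBitCov.rate n p t) +
          lam ^ 2 * OneBitCov.rate n p t)}) ∧
    ((∀ k, OneBitCov.HasGaussianTails μ κ (y k)) → ∀ b > (0 : ℝ), 2 ≤ n →
      2 * κ * Real.log n * OneBitCov.Cinf μ y ≤ lam ^ 2 →
      lam ^ 2 ≤ b * Real.log n * OneBitCov.Cinf μ y →
      1 - Real.exp (-t) ≤ μ.real {ω | OneBitCov.estError lam y τ τ' S ω ≤
        64 * (2 * √b + b) * (Real.log n *
            √(OneBitCov.Cop μ y * OneBitCov.Cinf μ y * OneBitCov.rate n p t) +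
          Real.log n * OneBitCov.Cinf μ y * OneBitCov.rate n p t)}) ∧
    (∀ M : ℝ, (∀ k, ∀ᵐ ω ∂μ, ∀ i, ‖y k ω i‖ ≤ M) → M ≤ lam →
      1 - Real.exp (-t) ≤ μ.real {ω | OneBitCov.estError lam y τ τ' S ω ≤
        64 * ((lam * √(OneBitCov.Cop μ y) + lam ^ 2) * √(OneBitCov.rate n p t) +
          lam ^ 2 * OneBitCov.rate n p t)}) := by
  have hmain := OneBitCov.estError_le_of_truncation hn hp hlam ht hpt hy hyL hdith hind hS
  have htails : (∀ k, OneBitCov.HasGaussianTails μ κ (y k)) → 2 ≤ n →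
      2 * κ * Real.log n * OneBitCov.Cinf μ y ≤ lam ^ 2 → _ := fun hG hn2 hB => hmain fun k =>
    (hG k).integral_norm_sub_clip_sq_le hlam hn2 (hy k) (hyL k) fun i =>
      (mul_le_mul_of_nonneg_left (OneBitCov.integral_norm_sq_le_Cinf y k i)
        (by positivity)).trans hB
  refine ⟨htails, fun hG b hb hn2 hB hb' => (htails hG hn2 hB).trans
    (measureReal_mono (Set.ofPred_subset_ofPred.2 fun ω hω => le_trans hω ?_)),
    fun M hM hMlam => hmain fun k => ?_⟩
  · have : NeZero n := ⟨Nat.one_le_iff_ne_zero.1 hn⟩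
    have : NeZero p := ⟨Nat.one_le_iff_ne_zero.1 hp⟩
    rw [mul_assoc]
    gcongr
    exact OneBitCov.bound_le_of_sq_le (OneBitCov.half_le_log hn2) (OneBitCov.Cinf_nonneg y)
      (OneBitCov.Cinf_le_Cop y) (OneBitCov.rate_nonneg hp ht) hb hb'
  · rw [OneBitCov.integral_norm_sub_clip_sq_eq_zero
      ((hM k).mono fun ω hω i => (hω i).trans hMlam)]
    positivity

theorem theorem5 (K : ℝ) (hK : 0 < K) :
    ∃ B > (0 : ℝ), ∃ C > (0 : ℝ), ∃ C' : ℝ → ℝ, (∀ b > (0 : ℝ), 0 < C' b) ∧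
    ∀ (𝕜 : Type*) [RCLike 𝕜] (Ω : Type*) [MeasurableSpace Ω] (μ : Measure Ω)
      [IsProbabilityMeasure μ] (n p : ℕ) (x e τ τ' : Fin n → Ω → Fin p → 𝕜)
      (ν lam t : ℝ) (Sx Se : Matrix (Fin p) (Fin p) 𝕜),
      1 ≤ n → 1 ≤ p → 0 < lam → 0 ≤ t → (2 ≤ p ∨ 1 ≤ t) →
      -- signals and noise
      (OneBitCov.DeterministicSignal x Sx ∨ OneBitCov.StochasticSignal μ K x Sx) →
      OneBitCov.NoiseModel μ K ν e Se →
      -- dithers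
      (∀ k, HasLaw (τ k) (OneBitCov.ditherVecLaw 𝕜 p lam) μ) →
      (∀ k, HasLaw (τ' k) (OneBitCov.ditherVecLaw 𝕜 p lam) μ) →
      -- signals, noise and dithers are all independent
      iIndepFun (Sum.elim (Sum.elim x e) (Sum.elim τ τ')) μ →
      -- (i)
      (2 ≤ n →
        B * Real.log n * OneBitCov.Cinf μ (OneBitCov.obs x e) ≤ lam ^ 2 →
        1 - Real.exp (-t) ≤
          μ.real {ω | OneBitCov.estError lam (OneBitCov.obs x e) τ τ' (Sx + Se) ω ≤
            C * ((lam * √(OneBitCov.Cop μ (OneBitCov.obs x e)) + lam ^ 2) *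
                √(OneBitCov.rate n p t) +
              lam ^ 2 * OneBitCov.rate n p t)}) ∧
      -- the special case of (i) in which `lam ^ 2` is of the order of `log n * Cinf`
      (∀ b > (0 : ℝ), 2 ≤ n →
        B * Real.log n * OneBitCov.Cinf μ (OneBitCov.obs x e) ≤ lam ^ 2 →
        lam ^ 2 ≤ b * Real.log n * OneBitCov.Cinf μ (OneBitCov.obs x e) →
        1 - Real.exp (-t) ≤
          μ.real {ω | OneBitCov.estError lam (OneBitCov.obs x e) τ τ' (Sx + Se) ω ≤
            C' b * (Real.log n *
                √(OneBitCov.Cop μ (OneBitCov.obs x e) * OneBitCov.Cinf μ (OneBitCov.obs x e) *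
                  OneBitCov.rate n p t) +
              Real.log n * OneBitCov.Cinf μ (OneBitCov.obs x e) * OneBitCov.rate n p t)}) ∧
      -- (ii)
      (∀ M : ℝ, (∀ k, ∀ᵐ ω ∂μ, ∀ i, ‖OneBitCov.obs x e k ω i‖ ≤ M) → M ≤ lam →
        1 - Real.exp (-t) ≤
          μ.real {ω | OneBitCov.estError lam (OneBitCov.obs x e) τ τ' (Sx + Se) ω ≤
            C * ((lam * √(OneBitCov.Cop μ (OneBitCov.obs x e)) + lam ^ 2) *
                √(OneBitCov.rate n p t) +
              lam ^ 2 * OneBitCov.rate n p t)}) := by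
  refine ⟨2 * (4 * (K ^ 2 + 1)), by positivity, 64, by norm_num, fun b => 64 * (2 * √b + b),
    fun b hb => by positivity, fun 𝕜 _ Ω _ μ _ n p x e τ τ' ν lam t Sx Se hn hp hlam ht hpt hx he
      hτ hτ' hind => ?_⟩
  have hxm : ∀ k, AEMeasurable (x k) μ := fun k => (OneBitCov.measurable_signal hx k).aemeasurable
  have hem : ∀ k, AEMeasurable (e k) μ := fun k => (he.measurable k).aemeasurable
  have hxe : ∀ k, IndepFun (x k) (e k) μ := fun k =>
    hind.indepFun (i := .inl (.inl k)) (j := .inl (.inr k)) (by simp)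
  have hG := OneBitCov.hasGaussianTails_obs hx he hxe
  obtain ⟨hi, hi', hii⟩ := theorem5_general (κ := 4 * (K ^ 2 + 1)) hn hp
    (by positivity) hlam ht hpt (OneBitCov.measurable_obs hx he) (OneBitCov.memLp_obs hx he)
    (OneBitCov.isDithered_add_of_iIndepFun hxm hem hτ hτ' hind)
    (OneBitCov.iIndepFun_add_prodMk hxm hem (fun k => (hτ k).aemeasurable)
      (fun k => (hτ' k).aemeasurable) hind)
    (OneBitCov.obs_cov_eq hx he (Nat.one_le_iff_ne_zero.1 hn) hxe)
  exact ⟨hi hG, hi' hG, hii⟩
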